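/- Let $\operatorname{Homeo}^+(\mathbb R)$ be the group of orientation preserving homeomorphisms of $\mathbb R$, let $\operatorname{supp} f=\{x\in\mathbb R: f(x)\neq x\}$, and let $F=\langle a,b\rangle\le\operatorname{Homeo}^+(\mathbb R)$ be the standard copy of Thompson's group, where $a(x)=x+1$, and $b(x)=x$ for $x\le 0$, $b(x)=2x$ for $0<x<1$, $b(x)=x+1$ for $x\ge 1$. For $m\ge 2$, an $m$-chain group is a subgroup $L=\langle f_1,\dots,f_m\rangle$ of $\operatorname{Homeo}^+(\mathbb R)$ such that - each $J_i=\operatorname{supp} f_i$ is a nonempty open (possibly unbounded) interval; $J_i\cap J_k=\varnothing$ whenever $|i-k|>1$; for $1\le i<m$ the set $J_i\cap J_{i+1}$ is nonempty and is a proper subset of both $J_i$ and $J_{i+1}$, and $\inf J_i<\inf J_{i+1}$ in $[-\infty,\infty]$; - $f_i(t)\ge t$ for all $i$ and all $t\in\mathbb R$; - $\langle f_i,f_{i+1}\rangle\cong F$ for $1\le i<m$. For a group $H$ write $H'=[H,H]$ for its commutator subgroup. **Theorem.** Let $n\ge 1$ and let $G=\langle h_1,\dots,h_n\rangle\le\operatorname{Homeo}^+(\mathbb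 R)$. 1. There is an $(n+2)$-chain group $L$ such that $L'$ is simple and $G$ embeds (as an abstract group) into $L$. 2. If $\operatorname{supp} h_i$ has finitely many connected components for some $i$, then there is an $(n+1)$-chain group $L$ such that $L'$ is simple and $G$ embeds into $L$. In both cases, if moreover $G/G'\cong\mathbb Z^n$, then $L$ can be chosen (still with $L'$ simple) so that $G$ embeds into $L'$. -/

import Mathlib

/-- The group `Homeo⁺(ℝ)` of orientation preserving (that is, strictly increasing)
homeomorphisms of the real line, under composition. -/
def HomeoPlus : Subgroup (ℝ ≃ₜ ℝ) where
  carrier := {f | StrictMono f}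
  one_mem' := fun _ _ hxy => hxy
  mul_mem' := fun {_ _} hf hg _ _ hxy => hf (hg hxy)
  inv_mem' := by
    intro f hf x y hxy
    by_contra hc
    have h1 : f (f⁻¹ y) ≤ f (f⁻¹ x) := hf.monotone (not_lt.mp hc)
    have h2 : ∀ z, f (f⁻¹ z) = z := fun z => f.apply_symm_apply z
    rw [h2, h2] at h1
    exact absurd hxy (not_lt.mpr h1)

namespace ChainGroup

/-- The (open) support `{x | f x ≠ x}` of `f ∈ Homeo⁺(ℝ)`. -/
def supp (f : HomeoPlus) : Set ℝ := {x | (f : ℝ ≃ₜ ℝ) x ≠ x}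

/-- The left endpoint of a set of reals, as an extended real number. -/
noncomputable def leftEndpoint (J : Set ℝ) : EReal := sInf ((fun x : ℝ => (x : EReal)) '' J)

/-- The translation `a(x) = x + 1`. -/
noncomputable def mapA : HomeoPlus :=
  ⟨Homeomorph.addRight (1 : ℝ), fun x y hxy => by simpa using hxy⟩

/-- The underlying function of `b`: the identity for `x ≤ 0`, `2x` for `0 < x < 1`,
and `x + 1` for `1 ≤ x`. -/
noncomputable def funB (x : ℝ) : ℝ := if x ≤ 0 then x else if x < 1 then 2 * x else x + 1

theorem strictMono_funB : StrictMono funB := by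
  intro x y hxy
  unfold funB
  split_ifs <;> linarith

theorem surjective_funB : Function.Surjective funB := by
  intro y
  by_cases h0 : y ≤ 0
  · exact ⟨y, by simp [funB, h0]⟩
  · by_cases h2 : y < 2
    · refine ⟨y / 2, ?_⟩
      rw [funB, if_neg (by linarith), if_pos (by linarith)]
      ring
    · refine ⟨y - 1, ?_⟩
      rw [funB, if_neg (by linarith), if_neg (by linarith)]
      ring

/-- The piecewise linear homeomorphism `b`, with underlying function `funB`. -/
noncomputable def mapB : HomeoPlus :=
  ⟨(strictMono_funB.orderIsoOfSurjective funB surjective_funB).toHomeomorph, strictMono_funB⟩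

/-- Thompson's group `F`, in its standard copy `⟨a, b⟩ ≤ Homeo⁺(ℝ)`. -/
noncomputable def ThompsonF : Subgroup HomeoPlus := Subgroup.closure {mapA, mapB}

/-- `J₁, …, Jₙ` are nonempty open intervals (possibly unbounded), non-consecutive ones are
disjoint, and consecutive ones meet in a nonempty proper subinterval of each of the two. -/
structure IsChainOfIntervals {n : ℕ} (J : Fin n → Set ℝ) : Prop where
  isOpen : ∀ i, IsOpen (J i)
  ordConnected : ∀ i, (J i).OrdConnected
  nonempty : ∀ i, (J i).Nonempty
  disjoint : ∀ i k : Fin n, (i : ℕ) + 1 < (k : ℕ) → J i ∩ J k = ∅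
  inter_nonempty : ∀ i k : Fin n, (i : ℕ) + 1 = (k : ℕ) → (J i ∩ J k).Nonempty
  inter_ssubset_left : ∀ i k : Fin n, (i : ℕ) + 1 = (k : ℕ) → J i ∩ J k ⊂ J i
  inter_ssubset_right : ∀ i k : Fin n, (i : ℕ) + 1 = (k : ℕ) → J i ∩ J k ⊂ J k

/-- `f₁, …, fₙ` (`n ≥ 2`) are supported on the members of a chain of intervals that is numbered
from left to right, and none of them moves a point to the left. The group generated by such a
family is a prechain group. -/
structure IsPrechainFamily {n : ℕ} (f : Fin n → HomeoPlus) : Prop where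
  two_le : 2 ≤ n
  chain : IsChainOfIntervals (fun i => supp (f i))
  left_lt : ∀ i k : Fin n, (i : ℕ) + 1 = (k : ℕ) →
    leftEndpoint (supp (f i)) < leftEndpoint (supp (f k))
  le_apply : ∀ (i : Fin n) (t : ℝ), t ≤ (f i : ℝ ≃ₜ ℝ) t

/-- `L ≤ Homeo⁺(ℝ)` is an `n`-chain group: it is generated by a prechain family `f₁, …, fₙ` any
two consecutive members of which generate a group isomorphic to Thompson's group `F`. -/
def IsChainGroup (n : ℕ) (L : Subgroup HomeoPlus) : Prop :=
  ∃ f : Fin n → HomeoPlus, IsPrechainFamily f ∧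
    (∀ i k : Fin n, (i : ℕ) + 1 = (k : ℕ) →
      Nonempty (Subgroup.closure {f i, f k} ≃* ThompsonF)) ∧
    L = Subgroup.closure (Set.range f)

/-- The set `S ⊆ ℝ` has finitely many connected components (possibly none). -/
def HasFinitelyManyComponents (S : Set ℝ) : Prop := Finite (ConnectedComponents S)

/-- The abstract group `G` embeds into the abstract group `H`. -/
def EmbedsInto (G H : Type*) [Group G] [Group H] : Prop :=
  ∃ φ : G →* H, Function.Injective φ

end ChainGroup

/-! Squeeze copies of generators of `G` into `(1/2, 3/4)`, call them `kⱼ`, and take `L = ⟨a, b, k₀,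
…, k_{m-1}⟩`. This is an `(m+2)`-chain group: put `B₀ = a`, `B_{j+1} = aʲ b kⱼ a⁻ʲ` for `j ≤ m` with
`k_m = 1`, and `B_{m+2} = 1`. Each `Bᵢ` with `1 ≤ i ≤ m+1` is the identity left of `i - 1` and
equals `a` right of `i`, so the quotients `fᵢ = B_{i+1}⁻¹ Bᵢ` push to the right and have overlapping
supports `(i-1, i+1)`, the two outer ones being unbounded. The perturbations `kⱼ` do not affect this
shape.

Neighbours `fᵢ, f_{i+1}` generate a copy of `F` for a dynamical reason. If `B` is the identity up to
`β` and agrees with `A` from `A β > β` on, then `A, B, ABA⁻¹, …` satisfy the infinite presentation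
of `F`, and the orbit of `β` tells its normal forms apart. Hence all such pairs generate isomorphic
groups.

`L'` is simple by Higman's argument: its elements have bounded support, and every element of `L`
agrees on any given compact set with an element of `L'`. Thus `L'` inherits from `F` the power to
contract compact sets into any open interval, and `L'` is perfect.

All `n` generators can be adjoined (`m = n`). A generator whose support has finitely many components
is conjugate into `F = ⟨a, b⟩`, so it need not be adjoined (`m = n - 1`). If `G/G' ≅ ℤⁿ`, each
generator can be multiplied by a translate of its inverse without losing the homomorphism, which
makes it a commutator. -/

namespace ChainGroup

open scoped commutatorElement

/-! ### The action on the line -/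

section Action

/-- `Homeo⁺(ℝ)` acts on the line by evaluation. -/
instance : MulAction HomeoPlus ℝ where
  smul f x := (f : ℝ ≃ₜ ℝ) x
  one_smul _ := rfl
  mul_smul _ _ _ := rfl

theorem homeo_ext {f g : HomeoPlus} (h : ∀ x : ℝ, f • x = g • x) : f = g :=
  Subtype.ext (Homeomorph.ext h)

theorem smul_strictMono (f : HomeoPlus) : StrictMono (fun x : ℝ => f • x) := f.2

@[simp] theorem homeo_smul_lt_smul (f : HomeoPlus) {x y : ℝ} : f • x < f • y ↔ x < y :=
  (smul_strictMono f).lt_iff_lt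

@[simp] theorem homeo_smul_le_smul (f : HomeoPlus) {x y : ℝ} : f • x ≤ f • y ↔ x ≤ y :=
  (smul_strictMono f).le_iff_le

theorem homeo_inv_smul_lt (f : HomeoPlus) {x y : ℝ} : f⁻¹ • x < y ↔ x < f • y := by
  rw [← homeo_smul_lt_smul f, smul_inv_smul]

theorem homeo_lt_inv_smul (f : HomeoPlus) {x y : ℝ} : x < f⁻¹ • y ↔ f • x < y := by
  rw [← homeo_smul_lt_smul f, smul_inv_smul]

theorem homeo_inv_smul_le (f : HomeoPlus) {x y : ℝ} : f⁻¹ • x ≤ y ↔ x ≤ f • y := by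
  rw [← homeo_smul_le_smul f, smul_inv_smul]

theorem homeo_le_inv_smul (f : HomeoPlus) {x y : ℝ} : x ≤ f⁻¹ • y ↔ f • x ≤ y := by
  rw [← homeo_smul_le_smul f, smul_inv_smul]

theorem smul_continuous (f : HomeoPlus) : Continuous (fun x : ℝ => f • x) :=
  (f : ℝ ≃ₜ ℝ).continuous

theorem mem_supp {f : HomeoPlus} {x : ℝ} : x ∈ supp f ↔ f • x ≠ x := Iff.rfl

/-- A strictly increasing surjection of the line, as an element of `Homeo⁺(ℝ)`. -/
noncomputable def ofStrictMono (f : ℝ → ℝ) (hf : StrictMono f) (hs : Function.Surjective f) :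
    HomeoPlus :=
  ⟨(hf.orderIsoOfSurjective f hs).toHomeomorph, hf⟩

@[simp] theorem ofStrictMono_smul (f : ℝ → ℝ) (hf : StrictMono f) (hs : Function.Surjective f)
    (x : ℝ) : ofStrictMono f hf hs • x = f x := rfl

@[simp] theorem mapA_smul (x : ℝ) : mapA • x = x + 1 := rfl

theorem mapB_smul (x : ℝ) : mapB • x = funB x := rfl

theorem mapA_inv_smul (x : ℝ) : mapA⁻¹ • x = x - 1 := by
  rw [inv_smul_eq_iff]; simp

theorem mapA_zpow_smul (n : ℤ) (x : ℝ) : (mapA ^ n) • x = x + n := by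
  induction n with
  | zero => simp
  | succ n ih => rw [zpow_add_one, (Commute.zpow_self mapA _).eq, mul_smul, ih]; simp; ring
  | pred n ih =>
    rw [zpow_sub_one, (Commute.inv_right (Commute.zpow_self mapA _)).eq, mul_smul, ih,
      mapA_inv_smul]
    simp; ring

end Action

/-! ### Normal forms and fractions from the relations of `F` -/

section Sorted

variable {Γ : Type*} [Group Γ]

/-- The sorted positive word `⋯ x_{k+1}^{e₁} x_k^{e₀}`. -/
def sortedProd (x : ℕ → Γ) : ℕ → List ℕ → Γ
  | _, [] => 1
  | k, e :: l => sortedProd x (k + 1) l * x k ^ e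

theorem sortedProd_head_tail (x : ℕ → Γ) (k : ℕ) (l : List ℕ) :
    sortedProd x k l = sortedProd x (k + 1) l.tail * x k ^ l.headD 0 := by
  cases l <;> simp [sortedProd]

/-- The relations of Thompson's group `F` in its infinite presentation. -/
def ThompsonRelations (x : ℕ → Γ) : Prop := ∀ j k, j < k → x j * x k = x (k + 1) * x j

variable {x : ℕ → Γ}

theorem ThompsonRelations.semiconjBy (hx : ThompsonRelations x) (l : List ℕ) :
    ∀ j k, j < k → SemiconjBy (x j) (sortedProd x k l) (sortedProd x (k + 1) l) := by
  induction l with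
  | nil => intro j k _; exact SemiconjBy.one_right _
  | cons e l ih =>
    intro j k hjk
    exact (ih j (k + 1) (by omega)).mul_right (SemiconjBy.pow_right (hx j k hjk) e)

theorem sortedProd_single (x : ℕ → Γ) (d : ℕ) :
    ∀ k, sortedProd x k (List.replicate d 0 ++ [1]) = x (k + d) := by
  induction d with
  | zero => intro k; simp [sortedProd]
  | succ d ih =>
    intro k
    simp only [List.replicate_succ, List.cons_append, sortedProd, ih, pow_zero, mul_one]
    congr 1; omega

/-- A new letter travels right past the larger indices, raising each by one, until it meets its own
power; the `0` in the new exponent list records this shift. -/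
theorem ThompsonRelations.mul_sortedProd (hx : ThompsonRelations x) (l : List ℕ) :
    ∀ j k, k ≤ j → ∃ l', x j * sortedProd x k l = sortedProd x k l' := by
  induction l with
  | nil =>
    intro j k hkj
    refine ⟨List.replicate (j - k) 0 ++ [1], ?_⟩
    rw [sortedProd_single, sortedProd, mul_one]
    congr 1; omega
  | cons e l ih =>
    intro j k hkj
    rcases hkj.lt_or_eq with h | rfl
    · obtain ⟨l', hl'⟩ := ih j (k + 1) h
      exact ⟨e :: l', by rw [sortedProd, sortedProd, ← mul_assoc, hl']⟩
    · refine ⟨(e + 1) :: 0 :: l, ?_⟩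
      rw [sortedProd, ← mul_assoc, (hx.semiconjBy l k (k + 1) (by omega)).eq]
      simp only [sortedProd, pow_zero, mul_one, pow_succ', mul_assoc]

theorem ThompsonRelations.exists_sortedProd (hx : ThompsonRelations x) {g : Γ}
    (hg : g ∈ Submonoid.closure (Set.range x)) : ∃ l, g = sortedProd x 0 l := by
  induction hg using Submonoid.closure_induction_left with
  | one => exact ⟨[], rfl⟩
  | mul_left y hy z _ ih =>
    obtain ⟨j, rfl⟩ := hy
    obtain ⟨l, rfl⟩ := ih
    exact hx.mul_sortedProd l j 0 (Nat.zero_le _)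

/-- Common left multiples of positive words. Keeping `v` a single letter or `1` is what lets the
induction on `q` proceed one letter at a time. -/
theorem ThompsonRelations.ore (hx : ThompsonRelations x) {q : Γ}
    (hq : q ∈ Submonoid.closure (Set.range x)) :
    ∀ j, ∃ q' ∈ Submonoid.closure (Set.range x), ∃ v, (v = 1 ∨ v ∈ Set.range x) ∧
      q' * x j = v * q := by
  have hgen : ∀ i j, ∃ u ∈ Submonoid.closure (Set.range x), ∃ v, (v = 1 ∨ v ∈ Set.range x) ∧
      u * x j = v * x i := by
    intro i j
    rcases lt_trichotomy i j with h | rfl | h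
    · exact ⟨x i, Submonoid.subset_closure ⟨i, rfl⟩, x (j + 1), Or.inr ⟨_, rfl⟩, hx i j h⟩
    · exact ⟨1, one_mem _, 1, Or.inl rfl, rfl⟩
    · exact ⟨x (i + 1), Submonoid.subset_closure ⟨_, rfl⟩, x j, Or.inr ⟨_, rfl⟩, (hx j i h).symm⟩
  induction hq using Submonoid.closure_induction_left with
  | one =>
    intro j
    exact ⟨1, one_mem _, x j, Or.inr ⟨j, rfl⟩, by simp⟩
  | mul_left y hy z _ ih =>
    intro j
    obtain ⟨i, rfl⟩ := hy
    obtain ⟨q', hq', v, hv, e⟩ := ih j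
    rcases hv with rfl | ⟨k, rfl⟩
    · exact ⟨x i * q', mul_mem (Submonoid.subset_closure ⟨i, rfl⟩) hq', 1, Or.inl rfl,
        by rw [mul_assoc, e, one_mul, one_mul]⟩
    · obtain ⟨u, hu, w, hw, e'⟩ := hgen i k
      exact ⟨u * q', mul_mem hu hq', w, hw, by rw [mul_assoc, e, ← mul_assoc, e', mul_assoc]⟩

theorem ThompsonRelations.exists_fraction (hx : ThompsonRelations x) {g : Γ}
    (hg : g ∈ Subgroup.closure (Set.range x)) :
    ∃ q ∈ Submonoid.closure (Set.range x), q * g ∈ Submonoid.closure (Set.range x) := by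
  induction hg using Subgroup.closure_induction_left with
  | one => exact ⟨1, one_mem _, by simp⟩
  | mul_left y hy z _ ih =>
    obtain ⟨j, rfl⟩ := hy
    obtain ⟨q, hq, hqz⟩ := ih
    obtain ⟨q', hq', v, hv, e⟩ := hx.ore hq j
    refine ⟨q', hq', ?_⟩
    rw [← mul_assoc, e, mul_assoc]
    refine mul_mem ?_ hqz
    rcases hv with rfl | hv
    · exact one_mem _
    · exact Submonoid.subset_closure hv
  | inv_mul_cancel y hy z _ ih =>
    obtain ⟨q, hq, hqz⟩ := ih
    exact ⟨q * y, mul_mem hq (Submonoid.subset_closure hy), by simpa [mul_assoc] using hqz⟩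

theorem pow_inv_smul_strictAnti {f : HomeoPlus} {p : ℝ} (hp : p < f • p) :
    StrictAnti (fun e : ℕ => (f ^ e)⁻¹ • p) := by
  refine strictAnti_nat_of_succ_lt fun e => ?_
  simp only [pow_succ', mul_inv_rev, mul_smul, homeo_smul_lt_smul, homeo_inv_smul_lt]
  exact hp

theorem sortedProd_inv_smul (y : ℕ → HomeoPlus) (p : ℝ) (l : List ℕ) :
    ∀ k, (∀ j, k ≤ j → y j • p = p) → (sortedProd y k l)⁻¹ • p = p := by
  induction l with
  | nil => intro k _; simp [sortedProd]
  | cons e l ih =>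
    intro k hk
    have h1 : y k ∈ MulAction.stabilizer HomeoPlus p := hk k le_rfl
    have h2 : y k ^ e • p = p := pow_mem h1 e
    rw [sortedProd, mul_inv_rev, mul_smul, ih (k + 1) fun j hj => hk j (by omega),
      inv_smul_eq_iff, h2]

theorem map_sortedProd (φ : Γ →* HomeoPlus) (l : List ℕ) :
    ∀ k, φ (sortedProd x k l) = sortedProd (fun j => φ (x j)) k l := by
  induction l with
  | nil => intro k; simp [sortedProd]
  | cons e l ih => intro k; simp [sortedProd, ih]

/-- The letters beyond `x k` fix `p k`, so the inverse of the word sends `p k` to `x_k^{-e₀} p k`,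
which determines `e₀`. Cancel this power and continue with the tail. Missing exponents count as `0`,
so words of different lengths can be compared. -/
theorem sortedProd_injOn (φ : Γ →* HomeoPlus) (p : ℕ → ℝ) (hp : ∀ k, p k < φ (x k) • p k)
    (hfix : ∀ k j, k < j → φ (x j) • p k = p k) (n : ℕ) :
    ∀ k (l l' : List ℕ), l.length ≤ n → l'.length ≤ n →
      φ (sortedProd x k l) = φ (sortedProd x k l') → sortedProd x k l = sortedProd x k l' := by
  induction n with
  | zero =>
    intro k l l' hl hl' _
    rw [List.length_eq_zero_iff.1 (Nat.le_zero.1 hl),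
      List.length_eq_zero_iff.1 (Nat.le_zero.1 hl')]
  | succ n ih =>
    intro k l l' hl hl' h
    rw [sortedProd_head_tail x k l, sortedProd_head_tail x k l'] at h ⊢
    simp only [map_mul, map_pow] at h
    have key : ∀ (m : List ℕ) (e : ℕ),
        (φ (sortedProd x (k + 1) m) * φ (x k) ^ e)⁻¹ • p k = (φ (x k) ^ e)⁻¹ • p k := by
      intro m e
      rw [mul_inv_rev, mul_smul, map_sortedProd,
        sortedProd_inv_smul _ _ _ _ fun j hj => hfix k j (by omega)]
    have he : l.headD 0 = l'.headD 0 := by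
      apply (pow_inv_smul_strictAnti (hp k)).injective
      simp only
      rw [← key l.tail, ← key l'.tail, h]
    rw [he] at h ⊢
    rw [ih (k + 1) l.tail l'.tail (by simp; omega) (by simp; omega) (mul_right_cancel h)]

/-- Write `g = q⁻¹ p` with `p, q` positive. If `φ g = 1`, then `p` and `q` have the same image,
hence are equal already in `Γ`. -/
theorem ThompsonRelations.injOn (hx : ThompsonRelations x) (φ : Γ →* HomeoPlus) (p : ℕ → ℝ)
    (hp : ∀ k, p k < φ (x k) • p k) (hfix : ∀ k j, k < j → φ (x j) • p k = p k) {g : Γ}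
    (hg : g ∈ Subgroup.closure (Set.range x)) (h : φ g = 1) : g = 1 := by
  obtain ⟨q, hq, hqg⟩ := hx.exists_fraction hg
  obtain ⟨l, hl⟩ := hx.exists_sortedProd hq
  obtain ⟨l', hl'⟩ := hx.exists_sortedProd hqg
  have : q * g = q := by
    rw [hl', hl]
    refine sortedProd_injOn φ p hp hfix (max l.length l'.length) 0 _ _ (le_max_right _ _)
      (le_max_left _ _) ?_
    rw [← hl, ← hl', map_mul, h, mul_one]
  simpa using this

end Sorted

/-! ### A dynamical criterion for generating `F` -/

section Pair

/-- `B` is the identity up to `β` and agrees with `A` from `A β > β` on. -/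
structure IsThompsonPair (A B : HomeoPlus) (β : ℝ) : Prop where
  lt : β < A • β
  left : ∀ t ≤ β, B • t = t
  right : ∀ t, A • β ≤ t → B • t = A • t

variable {Γ : Type*} [Group Γ]

/-- The infinite generating sequence `A, B, A B A⁻¹, A² B A⁻², …`. -/
def thompsonSeq (A B : Γ) : ℕ → Γ
  | 0 => A
  | k + 1 => A ^ k * B * (A ^ k)⁻¹

theorem closure_range_thompsonSeq (A B : Γ) :
    Subgroup.closure (Set.range (thompsonSeq A B)) = Subgroup.closure {A, B} := by
  have hA : A ∈ Subgroup.closure {A, B} := Subgroup.subset_closure (by simp)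
  have hB : B ∈ Subgroup.closure {A, B} := Subgroup.subset_closure (by simp)
  apply le_antisymm
  · rw [Subgroup.closure_le]
    rintro _ ⟨_ | k, rfl⟩
    · exact hA
    · exact mul_mem (mul_mem (pow_mem hA k) hB) (inv_mem (pow_mem hA k))
  · rw [Subgroup.closure_le]
    rintro y (rfl | rfl)
    · exact Subgroup.subset_closure ⟨0, rfl⟩
    · exact Subgroup.subset_closure ⟨1, by simp [thompsonSeq]⟩

theorem map_thompsonSeq {Δ : Type*} [Group Δ] (φ : Γ →* Δ) (A B : Γ) (k : ℕ) :
    φ (thompsonSeq A B k) = thompsonSeq (φ A) (φ B) k := by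
  cases k <;> simp [thompsonSeq]

variable {A B : HomeoPlus} {β : ℝ}

theorem IsThompsonPair.smul_of_le (h : IsThompsonPair A B β) {k : ℕ} {t : ℝ}
    (ht : t ≤ A ^ k • β) : thompsonSeq A B (k + 1) • t = t := by
  rw [thompsonSeq, mul_smul, mul_smul, h.left _ (by rwa [homeo_inv_smul_le]), smul_inv_smul]

theorem IsThompsonPair.smul_of_ge (h : IsThompsonPair A B β) {k : ℕ} {t : ℝ}
    (ht : A ^ (k + 1) • β ≤ t) : thompsonSeq A B (k + 1) • t = A • t := by
  rw [thompsonSeq, mul_smul, mul_smul, h.right, ← mul_smul, ← pow_succ, pow_succ', mul_smul,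
    smul_inv_smul]
  rwa [homeo_le_inv_smul, ← mul_smul, ← pow_succ]

theorem IsThompsonPair.strictMono (h : IsThompsonPair A B β) :
    StrictMono (fun k : ℕ => A ^ k • β) := by
  refine strictMono_nat_of_lt_succ fun k => ?_
  rw [pow_succ, mul_smul, homeo_smul_lt_smul]
  exact h.lt

theorem IsThompsonPair.relations (h : IsThompsonPair A B β) :
    ThompsonRelations (thompsonSeq A B) := by
  have hA : ∀ k, A * thompsonSeq A B (k + 1) = thompsonSeq A B (k + 2) * A := by
    intro k; simp only [thompsonSeq, pow_succ']; group
  rintro (_ | j) (_ | k) hjk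
  · omega
  · exact hA k
  · omega
  refine homeo_ext fun t => ?_
  simp only [mul_smul]
  have hge : ∀ {t : ℝ}, A ^ k • β ≤ t → thompsonSeq A B (j + 1) • t = A • t := fun ht =>
    h.smul_of_ge ((h.strictMono.monotone (by omega)).trans ht)
  rcases le_total t (A ^ k • β) with ht | ht
  -- Left of `Aᵏ β` both conjugates act trivially; right of it `x_{j+1}` acts as `A`, and
  -- conjugation by `A` shifts the index.
  · rw [h.smul_of_le ht, h.smul_of_le (k := k + 1)]
    rw [← homeo_smul_le_smul (thompsonSeq A B (j + 1)), hge le_rfl] at ht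
    rwa [pow_succ', mul_smul]
  · have ht' : A ^ k • β ≤ thompsonSeq A B (k + 1) • t := by
      rw [← h.smul_of_le (le_refl (A ^ k • β)), homeo_smul_le_smul]; exact ht
    rw [hge ht, hge ht', ← mul_smul, ← mul_smul, hA]

/-- The points detecting the exponents of a sorted positive word. -/
theorem IsThompsonPair.lt_smul (h : IsThompsonPair A B β) (k : ℕ) :
    A ^ k • β < thompsonSeq A B k • A ^ k • β := by
  have h1 : A ^ k • β < A ^ (k + 1) • β := h.strictMono (by omega)
  rw [pow_succ', mul_smul] at h1
  cases k with
  | zero => exact h1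
  | succ k => rwa [h.smul_of_ge le_rfl]

theorem IsThompsonPair.smul_eq (h : IsThompsonPair A B β) {k j : ℕ} (hkj : k < j) :
    thompsonSeq A B j • A ^ k • β = A ^ k • β := by
  obtain ⟨j, rfl⟩ : ∃ i, j = i + 1 := ⟨j - 1, by omega⟩
  exact h.smul_of_le (h.strictMono.monotone (by omega))

theorem IsThompsonPair.prod_relations {A' B' : HomeoPlus} {β' : ℝ} (h : IsThompsonPair A B β)
    (h' : IsThompsonPair A' B' β') : ThompsonRelations (thompsonSeq (A, A') (B, B')) := by
  have h1 : ∀ k, (thompsonSeq (A, A') (B, B') k).1 = thompsonSeq A B k :=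
    map_thompsonSeq (MonoidHom.fst HomeoPlus HomeoPlus) _ _
  have h2 : ∀ k, (thompsonSeq (A, A') (B, B') k).2 = thompsonSeq A' B' k :=
    map_thompsonSeq (MonoidHom.snd HomeoPlus HomeoPlus) _ _
  intro j k hjk
  ext1
  · simp only [Prod.fst_mul, h1]; exact h.relations j k hjk
  · simp only [Prod.snd_mul, h2]; exact h'.relations j k hjk

theorem closure_pair_equiv_of_injOn {A₀ B₀ : Γ} (φ : Γ →* HomeoPlus)
    (hφ : ∀ g ∈ Subgroup.closure {A₀, B₀}, φ g = 1 → g = 1) :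
    Nonempty (Subgroup.closure {A₀, B₀} ≃* Subgroup.closure {φ A₀, φ B₀}) := by
  have e : (Subgroup.closure {A₀, B₀}).map φ = Subgroup.closure {φ A₀, φ B₀} := by
    rw [MonoidHom.map_closure, Set.image_pair]
  rw [← e]
  refine ⟨MulEquiv.ofBijective (φ.subgroupMap _) ⟨?_, φ.subgroupMap_surjective _⟩⟩
  rw [injective_iff_map_eq_one]
  rintro ⟨g, hg⟩ hgg
  exact Subtype.ext (hφ g hg (congrArg Subtype.val hgg))

/-- Any two Thompson pairs generate isomorphic groups. -/
theorem IsThompsonPair.nonempty_mulEquiv {A' B' : HomeoPlus} {β' : ℝ}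
    (h : IsThompsonPair A B β) (h' : IsThompsonPair A' B' β') :
    Nonempty (Subgroup.closure {A, B} ≃* Subgroup.closure {A', B'}) := by
  -- The diagonal pair in the product satisfies the same relations, so both projections of the group
  -- it generates are injective; this group is the bridge between the two.
  have hr := h.prod_relations h'
  have h1 := closure_pair_equiv_of_injOn (A₀ := (A, A')) (B₀ := (B, B'))
    (MonoidHom.fst HomeoPlus HomeoPlus) (by
      rw [← closure_range_thompsonSeq]
      intro g hg hg1
      refine hr.injOn _ (fun k => A ^ k • β) ?_ ?_ hg hg1
      · intro k; rw [map_thompsonSeq]; exact h.lt_smul k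
      · intro k j hkj; rw [map_thompsonSeq]; exact h.smul_eq hkj)
  have h2 := closure_pair_equiv_of_injOn (A₀ := (A, A')) (B₀ := (B, B'))
    (MonoidHom.snd HomeoPlus HomeoPlus) (by
      rw [← closure_range_thompsonSeq]
      intro g hg hg1
      refine hr.injOn _ (fun k => A' ^ k • β') ?_ ?_ hg hg1
      · intro k; rw [map_thompsonSeq]; exact h'.lt_smul k
      · intro k j hkj; rw [map_thompsonSeq]; exact h'.smul_eq hkj)
  obtain ⟨e1⟩ := h1
  obtain ⟨e2⟩ := h2
  exact ⟨e1.symm.trans e2⟩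

theorem mapB_smul_of_nonpos {t : ℝ} (ht : t ≤ 0) : mapB • t = t := by
  rw [mapB_smul, funB, if_pos ht]

theorem mapB_smul_of_one_le {t : ℝ} (ht : 1 ≤ t) : mapB • t = t + 1 := by
  rw [mapB_smul, funB, if_neg (by linarith), if_neg (by linarith)]

theorem mapB_smul_of_mem {t : ℝ} (h0 : 0 ≤ t) (h1 : t ≤ 1) : mapB • t = 2 * t := by
  rw [mapB_smul, funB]
  split_ifs <;> linarith

theorem isThompsonPair_mapA_mapB : IsThompsonPair mapA mapB 0 where
  lt := by simp
  left _ ht := mapB_smul_of_nonpos ht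
  right t ht := by
    rw [mapA_smul, zero_add] at ht
    rw [mapA_smul, mapB_smul_of_one_le ht]

end Pair

theorem mapA_pow_smul (n : ℕ) (x : ℝ) : (mapA ^ n) • x = x + n := by
  have := mapA_zpow_smul n x
  simpa using this

theorem mapA_pow_inv_smul (n : ℕ) (x : ℝ) : (mapA ^ n)⁻¹ • x = x - n := by
  rw [inv_smul_eq_iff, mapA_pow_smul]; ring

/-! ### The perturbed chain -/

section Chain

/-- Perturbations of `B 0 = a`, `B (j + 1) = aʲ b a⁻ʲ` for `j ≤ m`, and `B (m + 2) = 1`. -/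
noncomputable def chainB (m : ℕ) (κ : ℕ → HomeoPlus) : ℕ → HomeoPlus
  | 0 => mapA
  | j + 1 => if j ≤ m then mapA ^ j * (mapB * κ j) * (mapA ^ j)⁻¹ else 1

/-- The chain of homeomorphisms obtained from `chainB`. -/
noncomputable def chainMap (m : ℕ) (κ : ℕ → HomeoPlus) (i : ℕ) : HomeoPlus :=
  (chainB m κ (i + 1))⁻¹ * chainB m κ i

variable {m : ℕ} {κ : ℕ → HomeoPlus}

theorem smul_mem_Ioo_of_fix {k : HomeoPlus} {u v : ℝ} (hk : ∀ t ∉ Set.Ioo u v, k • t = t) {t : ℝ}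
    (ht : t ∈ Set.Ioo u v) : k • t ∈ Set.Ioo u v := by
  constructor
  · rw [← hk u (by simp), homeo_smul_lt_smul]; exact ht.1
  · rw [← hk v (by simp), homeo_smul_lt_smul]; exact ht.2

/-- The choice of `(1/2, 3/4)`: `b` maps it onto `(1, 3/2)`, which lies right of `3/4` and left of
`1/2 + 1`, so `t < b k t < t + 1` survives any perturbation there. -/
theorem mapB_mul_smul {k : HomeoPlus} (hk : ∀ t ∉ Set.Ioo (1 / 2 : ℝ) (3 / 4), k • t = t) (t : ℝ) :
    (t ≤ 0 → (mapB * k) • t = t) ∧ (1 ≤ t → (mapB * k) • t = t + 1) ∧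
      (0 < t → t < (mapB * k) • t) ∧ (t < 1 → (mapB * k) • t < t + 1) := by
  have h1 : t ≤ 0 → (mapB * k) • t = t := fun ht => by
    rw [mul_smul, hk t (fun h => by linarith [h.1]), mapB_smul_of_nonpos ht]
  have h2 : 1 ≤ t → (mapB * k) • t = t + 1 := fun ht => by
    rw [mul_smul, hk t (fun h => by linarith [h.2]), mapB_smul_of_one_le ht]
  have h3 : 0 < t → t < 1 → t < (mapB * k) • t ∧ (mapB * k) • t < t + 1 := fun h0 h1 => by
    rw [mul_smul]
    by_cases ht : t ∈ Set.Ioo (1 / 2 : ℝ) (3 / 4)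
    · obtain ⟨h5, h6⟩ := smul_mem_Ioo_of_fix hk ht
      rw [mapB_smul_of_mem (by linarith) (by linarith)]
      constructor <;> linarith [ht.1, ht.2]
    · rw [hk t ht, mapB_smul_of_mem h0.le h1.le]
      constructor <;> linarith
  refine ⟨h1, h2, fun h0 => ?_, fun h0 => ?_⟩
  · rcases lt_or_ge t 1 with h | h
    · exact (h3 h0 h).1
    · rw [h2 h]; linarith
  · rcases lt_or_ge 0 t with h | h
    · exact (h3 h h0).2
    · rw [h1 h]; linarith

variable (hκ : ∀ j, ∀ t ∉ Set.Ioo (1 / 2 : ℝ) (3 / 4), κ j • t = t)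

theorem chainB_last : chainB m κ (m + 2) = 1 := by
  simp [chainB]

theorem chainB_succ_smul {j : ℕ} (hj : j ≤ m) (t : ℝ) :
    chainB m κ (j + 1) • t = (mapB * κ j) • (t - j) + j := by
  rw [chainB, if_pos hj, mul_smul, mul_smul, mapA_pow_inv_smul, mapA_pow_smul]

include hκ

theorem chainB_smul_of_ge {i : ℕ} (hi : i ≤ m + 1) {t : ℝ} (ht : i ≤ t) :
    chainB m κ i • t = t + 1 := by
  cases i with
  | zero => rfl
  | succ j =>
    push_cast at ht
    rw [chainB_succ_smul (by omega), (mapB_mul_smul (hκ j) _).2.1 (by linarith)]; ring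

theorem chainB_smul_lt {i : ℕ} (hi : i ≤ m + 1) (h0 : i ≠ 0) {t : ℝ} (ht : t < i) :
    chainB m κ i • t < t + 1 := by
  cases i with
  | zero => exact absurd rfl h0
  | succ j =>
    push_cast at ht
    rw [chainB_succ_smul (by omega)]
    linarith [(mapB_mul_smul (hκ j) (t - j)).2.2.2 (by linarith)]

theorem lt_chainB_smul {i : ℕ} (hi : i ≤ m + 1) {t : ℝ} (ht : i = 0 ∨ (i : ℝ) < t + 1) :
    t < chainB m κ i • t := by
  cases i with
  | zero => simp [chainB]
  | succ j =>
    have ht' := ht.resolve_left (by omega)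
    push_cast at ht'
    rw [chainB_succ_smul (by omega)]
    linarith [(mapB_mul_smul (hκ j) (t - j)).2.2.1 (by linarith)]

theorem chainB_smul_of_le {i : ℕ} (h0 : i ≠ 0) {t : ℝ} (ht : t + 1 ≤ i) :
    chainB m κ i • t = t := by
  cases i with
  | zero => exact absurd rfl h0
  | succ j =>
    push_cast at ht
    by_cases hj : j ≤ m
    · rw [chainB_succ_smul hj, (mapB_mul_smul (hκ j) _).1 (by linarith)]; ring
    · rw [chainB, if_neg hj, one_smul]

/-- The claim amounts to `B_{i+1} t < Bᵢ t`. Left of `i` the map `B_{i+1}` is still the identity;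
from `i` on `Bᵢ` is already the full translation. -/
theorem lt_chainMap_smul {i : ℕ} (hi : i ≤ m + 1) {t : ℝ} (h1 : i = 0 ∨ (i : ℝ) < t + 1)
    (h2 : i = m + 1 ∨ t < i + 1) : t < chainMap m κ i • t := by
  rw [chainMap, mul_smul, homeo_lt_inv_smul]
  rcases hi.lt_or_eq with h | rfl
  · have h2' := h2.resolve_left (by omega)
    rcases lt_or_ge t i with hti | hti
    · rw [chainB_smul_of_le hκ (by omega) (by push_cast; linarith)]
      exact lt_chainB_smul hκ hi h1
    · rw [chainB_smul_of_ge hκ hi hti]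
      exact chainB_smul_lt hκ (by omega) (by omega) (by push_cast; linarith)
  · rw [chainB_last, one_smul]
    exact lt_chainB_smul hκ le_rfl h1

theorem chainMap_smul_of_le {i : ℕ} (h0 : i ≠ 0) {t : ℝ} (h1 : t + 1 ≤ i) :
    chainMap m κ i • t = t := by
  rw [chainMap, mul_smul, inv_smul_eq_iff, chainB_smul_of_le hκ h0 h1,
    chainB_smul_of_le hκ (by omega) (by push_cast; linarith)]

theorem chainMap_smul_of_ge {i : ℕ} (hi : i ≤ m) {t : ℝ} (h1 : i + 1 ≤ t) :
    chainMap m κ i • t = t := by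
  rw [chainMap, mul_smul, inv_smul_eq_iff, chainB_smul_of_ge hκ (by omega) (by linarith),
    chainB_smul_of_ge hκ (by omega) (by push_cast; linarith)]

theorem supp_chainMap {i : ℕ} (hi : i ≤ m + 1) : supp (chainMap m κ i) =
    {t : ℝ | (i = 0 ∨ (i : ℝ) < t + 1) ∧ (i = m + 1 ∨ t < i + 1)} := by
  ext t
  rw [mem_supp, Set.mem_ofPred_eq]
  constructor
  · intro h
    by_contra hc
    rw [not_and_or, not_or, not_or, not_lt, not_lt] at hc
    rcases hc with hc | hc
    · exact h (chainMap_smul_of_le hκ hc.1 hc.2)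
    · exact h (chainMap_smul_of_ge hκ (by omega) hc.2)
  · intro h
    exact (lt_chainMap_smul hκ hi h.1 h.2).ne'

theorem le_chainMap_smul {i : ℕ} (hi : i ≤ m + 1) (t : ℝ) : t ≤ chainMap m κ i • t := by
  by_cases h : t ∈ supp (chainMap m κ i)
  · rw [supp_chainMap hκ hi] at h
    exact (lt_chainMap_smul hκ hi h.1 h.2).le
  · rw [mem_supp, not_not] at h
    exact h.ge

theorem isPrechainFamily_chainMap :
    IsPrechainFamily (fun i : Fin (m + 2) => chainMap m κ i) where
  two_le := by omega
  chain := by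
    have hs : (fun i : Fin (m + 2) => supp (chainMap m κ i)) = fun i : Fin (m + 2) =>
        {t : ℝ | ((i : ℕ) = 0 ∨ ((i : ℕ) : ℝ) < t + 1) ∧
          ((i : ℕ) = m + 1 ∨ t < ((i : ℕ) : ℝ) + 1)} :=
      funext fun i => supp_chainMap hκ (by omega)
    rw [hs]
    have hcast : ∀ i k : Fin (m + 2), (i : ℕ) + 1 = k → ((k : ℕ) : ℝ) = (i : ℕ) + 1 := by
      intro i k h; rw [← h]; push_cast; ring
    refine ⟨fun i => ?_, fun i => ⟨?_⟩, fun i => ⟨((i : ℕ) : ℝ), ?_⟩, fun i k hik => ?_,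
      fun i k hik => ⟨((i : ℕ) : ℝ) + 1 / 2, ?_, ?_⟩, fun i k hik => ?_, fun i k hik => ?_⟩
    · simp only [Set.ofPred_and, Set.ofPred_or]
      exact (isOpen_const.union (isOpen_lt (by fun_prop) (by fun_prop))).inter
        (isOpen_const.union (isOpen_lt (by fun_prop) (by fun_prop)))
    · rintro x ⟨hx1, hx2⟩ y ⟨hy1, hy2⟩ z ⟨hz1, hz2⟩
      refine ⟨hx1.imp_right fun h => by linarith, hy2.imp_right fun h => by linarith⟩
    · exact ⟨Or.inr (by linarith), Or.inr (by linarith)⟩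
    · rw [Set.eq_empty_iff_forall_notMem]
      rintro t ⟨⟨_, h1⟩, ⟨h2, _⟩⟩
      have h1' := h1.resolve_left (by omega)
      have h2' := h2.resolve_left (by omega)
      have : ((i : ℕ) : ℝ) + 2 ≤ (k : ℕ) := by exact_mod_cast hik
      linarith
    · exact ⟨Or.inr (by linarith), Or.inr (by linarith)⟩
    · exact ⟨Or.inr (by rw [hcast i k hik]; linarith), Or.inr (by rw [hcast i k hik]; linarith)⟩
    · rw [Set.inter_ssubset_left_iff]
      intro hsub
      have := (hsub (a := ((i : ℕ) : ℝ))
        ⟨Or.inr (by linarith), Or.inr (by linarith)⟩).1.resolve_left (by omega)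
      rw [hcast i k hik] at this
      linarith
    · rw [Set.inter_ssubset_right_iff]
      intro hsub
      have := (hsub (a := ((k : ℕ) : ℝ))
        ⟨Or.inr (by linarith), Or.inr (by linarith)⟩).2.resolve_left (by omega)
      rw [hcast i k hik] at this
      linarith
  left_lt := by
    intro i k hik
    rw [supp_chainMap hκ (by omega), supp_chainMap hκ (by omega)]
    have hcast : ((k : ℕ) : ℝ) = (i : ℕ) + 1 := by rw [← hik]; push_cast; ring
    refine lt_of_le_of_lt (sInf_le (a := ((((i : ℕ) : ℝ) - 1 / 2 : ℝ) : EReal)) ⟨_, ?_, rfl⟩)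
      (lt_of_lt_of_le (b := ((((i : ℕ) : ℝ) : ℝ) : EReal)) ?_ (le_sInf ?_))
    · exact ⟨Or.inr (by linarith), Or.inr (by linarith)⟩
    · rw [EReal.coe_lt_coe_iff]; linarith
    · rintro _ ⟨t, ⟨h1, _⟩, rfl⟩
      have := h1.resolve_left (by omega)
      rw [EReal.coe_le_coe_iff]
      linarith
  le_apply i t := le_chainMap_smul hκ (by omega) t

/-- In the product `B_{i+2}⁻¹ Bᵢ` the middle term cancels, and `i` goes to `i + 1`, exactly where
the support of `fᵢ` ends. -/
theorem isThompsonPair_chainMap {i : ℕ} (hi : i ≤ m) :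
    IsThompsonPair (chainMap m κ (i + 1) * chainMap m κ i) (chainMap m κ (i + 1)) i := by
  have hA : (chainMap m κ (i + 1) * chainMap m κ i) • (i : ℝ) = i + 1 := by
    rw [chainMap, chainMap, mul_assoc, mul_inv_cancel_left, mul_smul, inv_smul_eq_iff,
      chainB_smul_of_ge hκ (by omega) le_rfl, chainB_smul_of_le hκ (by omega)]
    push_cast; linarith
  refine ⟨?_, fun t ht => ?_, fun t ht => ?_⟩
  · rw [hA]; linarith
  · exact chainMap_smul_of_le hκ (by omega) (by push_cast; linarith)
  · rw [hA] at ht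
    rw [mul_smul, chainMap_smul_of_ge hκ hi ht]

theorem chainMap_pair_equiv {i : ℕ} (hi : i ≤ m) :
    Nonempty (Subgroup.closure {chainMap m κ i, chainMap m κ (i + 1)} ≃* ThompsonF) := by
  have : Subgroup.closure {chainMap m κ i, chainMap m κ (i + 1)} =
      Subgroup.closure {chainMap m κ (i + 1) * chainMap m κ i, chainMap m κ (i + 1)} := by
    apply le_antisymm
    · rw [Subgroup.closure_le]
      have h1 : chainMap m κ (i + 1) ∈ Subgroup.closure
          {chainMap m κ (i + 1) * chainMap m κ i, chainMap m κ (i + 1)} :=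
        Subgroup.subset_closure (by simp)
      rintro y (rfl | rfl)
      · exact ((Subgroup.mul_mem_cancel_left _ h1).1 (Subgroup.subset_closure (by simp)))
      · exact h1
    · rw [Subgroup.closure_le]
      have h1 : chainMap m κ (i + 1) ∈ Subgroup.closure
          {chainMap m κ i, chainMap m κ (i + 1)} := Subgroup.subset_closure (by simp)
      rintro y (rfl | rfl)
      · exact mul_mem h1 (Subgroup.subset_closure (by simp))
      · exact h1
  rw [this]
  exact (isThompsonPair_chainMap hκ hi).nonempty_mulEquiv isThompsonPair_mapA_mapB

end Chain

/-- The group generated by `a`, `b` and the members of a family `k`. -/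
noncomputable def extGroup {m : ℕ} (k : Fin m → HomeoPlus) : Subgroup HomeoPlus :=
  Subgroup.closure ({mapA, mapB} ∪ Set.range k)

/-! ### `⟨a, b, k⟩` is a chain group -/

section Ext

variable {m : ℕ} (k : Fin m → HomeoPlus)

theorem mapA_mem : mapA ∈ extGroup k := Subgroup.subset_closure (by simp)

theorem mapB_mem : mapB ∈ extGroup k := Subgroup.subset_closure (by simp)

theorem mem_extGroup (i : Fin m) : k i ∈ extGroup k := Subgroup.subset_closure (by simp)

theorem thompsonF_le : ThompsonF ≤ extGroup k :=
  Subgroup.closure_mono Set.subset_union_left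

theorem extGroup_eq_closure_chainMap :
    extGroup k = Subgroup.closure (Set.range (fun i : Fin (m + 2) =>
      chainMap m (fun j => if h : j < m then k ⟨j, h⟩ else 1) i)) := by
  set κ : ℕ → HomeoPlus := fun j => if h : j < m then k ⟨j, h⟩ else 1 with hκ
  apply le_antisymm
  · set C := Subgroup.closure (Set.range (fun i : Fin (m + 2) => chainMap m κ i)) with hC
    -- The products of the chain maps telescope, so every `Bᵢ` is recovered by descending from
    -- `B_{m+2} = 1`.
    have hB : ∀ i, i ≤ m + 2 → chainB m κ i ∈ C := by
      intro i hi
      induction hi using Nat.decreasingInduction with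
      | self => rw [chainB_last]; exact one_mem _
      | of_succ i hi ih =>
        have h1 : chainMap m κ i ∈ C := Subgroup.subset_closure ⟨⟨i, hi⟩, rfl⟩
        have := mul_mem ih h1
        rwa [chainMap, mul_inv_cancel_left] at this
    have hA : mapA ∈ C := hB 0 (by omega)
    have hBκ : ∀ j ≤ m, mapB * κ j ∈ C := by
      intro j hj
      have h1 := hB (j + 1) (by omega)
      rw [chainB, if_pos hj] at h1
      have h2 := mul_mem (mul_mem (inv_mem (pow_mem hA j)) h1) (pow_mem hA j)
      convert h2 using 1
      group
    -- The last slot is unperturbed and yields `b` itself; dividing by it frees each `κ j`.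
    have hb : mapB ∈ C := by simpa [hκ] using hBκ m le_rfl
    rw [extGroup, Subgroup.closure_le]
    rintro y ((rfl | rfl) | ⟨i, rfl⟩)
    · exact hA
    · exact hb
    · have := (Subgroup.mul_mem_cancel_left _ hb).1 (hBκ i i.2.le)
      simpa [hκ] using this
  · have hB : ∀ i, chainB m κ i ∈ extGroup k := by
      rintro (_ | j)
      · exact mapA_mem k
      · rw [chainB]
        split_ifs with hj
        · have hκj : κ j ∈ extGroup k := by
            simp only [hκ]
            split_ifs
            · exact mem_extGroup k _
            · exact one_mem _
          exact mul_mem (mul_mem (pow_mem (mapA_mem k) j) (mul_mem (mapB_mem k) hκj))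
            (inv_mem (pow_mem (mapA_mem k) j))
        · exact one_mem _
    rw [Subgroup.closure_le]
    rintro _ ⟨i, rfl⟩
    exact mul_mem (inv_mem (hB _)) (hB _)

theorem isChainGroup_extGroup (hk : ∀ i, ∀ t ∉ Set.Ioo (1 / 2 : ℝ) (3 / 4), k i • t = t) :
    IsChainGroup (m + 2) (extGroup k) := by
  have hκ : ∀ j, ∀ t ∉ Set.Ioo (1 / 2 : ℝ) (3 / 4),
      (if h : j < m then k ⟨j, h⟩ else 1) • t = t := by
    intro j t ht
    split_ifs
    · exact hk _ t ht
    · exact one_smul _ t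
  refine ⟨_, isPrechainFamily_chainMap hκ, ?_, extGroup_eq_closure_chainMap k⟩
  intro i j hij
  rw [← hij]
  exact chainMap_pair_equiv hκ (by omega)

end Ext

theorem commute_of_fix {f g : HomeoPlus} {I : Set ℝ} (hf : ∀ t ∈ I, f • t = t)
    (hg : ∀ t ∉ I, g • t = t) : Commute f g := by
  refine homeo_ext fun t => ?_
  rw [mul_smul f, mul_smul g]
  by_cases ht : t ∈ I
  · rw [hf t ht]
    refine hf _ ?_
    by_contra hc
    have := hg _ hc
    rw [smul_left_cancel_iff] at this
    exact hc (this.symm ▸ ht)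
  · rw [hg t ht]
    refine (hg _ fun hc => ?_).symm
    have := hf _ hc
    rw [smul_left_cancel_iff] at this
    exact ht (this ▸ hc)

/-! ### `F` contracts compact sets -/

section Contraction

/-- Otherwise the supremum of the orbit would be moved to the right, and the orbit would pass it. -/
theorem exists_lt_pow_smul (h : HomeoPlus) {t s : ℝ} (hh : ∀ r ∈ Set.Icc t s, r < h • r) :
    ∃ n : ℕ, s < h ^ n • t := by
  by_contra! hc
  have hbdd : BddAbove (Set.range fun n : ℕ => h ^ n • t) := ⟨s, by rintro _ ⟨n, rfl⟩; exact hc n⟩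
  have hle : ∀ n : ℕ, h ^ n • t ≤ ⨆ n : ℕ, h ^ n • t := fun n => le_ciSup hbdd n
  have h1 := hh (⨆ n : ℕ, h ^ n • t) ⟨by simpa using hle 0, ciSup_le hc⟩
  rw [← homeo_inv_smul_lt] at h1
  obtain ⟨n, hn⟩ := exists_lt_of_lt_ciSup h1
  rw [homeo_inv_smul_lt, ← mul_smul, ← pow_succ'] at hn
  exact absurd (hle (n + 1)) (not_le.2 hn)

theorem lt_mapB_smul {t : ℝ} (ht : 0 < t) : t < mapB • t := by
  rcases le_total t 1 with h | h
  · rw [mapB_smul_of_mem ht.le h]; linarith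
  · rw [mapB_smul_of_one_le h]; linarith

theorem mapA_mem_thompsonF : mapA ∈ ThompsonF := Subgroup.subset_closure (by simp)

theorem mapB_mem_thompsonF : mapB ∈ ThompsonF := Subgroup.subset_closure (by simp)

theorem exists_smul_zero_eq_dyadic (k : ℕ) :
    ∀ m : ℤ, ∃ g ∈ ThompsonF, g • (0 : ℝ) = m / 2 ^ k := by
  induction k with
  | zero =>
    intro m
    exact ⟨mapA ^ m, zpow_mem mapA_mem_thompsonF m, by rw [mapA_zpow_smul]; simp⟩
  | succ k ih =>
    intro m
    set q : ℝ := m / 2 ^ (k + 1) with hq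
    set j : ℤ := ⌊q⌋
    obtain ⟨g, hg, hg0⟩ := ih (m - j * 2 ^ k)
    have hA := zpow_mem mapA_mem_thompsonF j
    -- On `[j, j+1]` the translate of `b` is `t ↦ 2t - j`, and `2q - j` has denominator `2 ^ k`.
    refine ⟨(mapA ^ j * mapB * (mapA ^ j)⁻¹)⁻¹ * g,
      mul_mem (inv_mem (mul_mem (mul_mem hA mapB_mem_thompsonF) (inv_mem hA))) hg, ?_⟩
    rw [mul_smul, inv_smul_eq_iff, hg0, mul_smul, mul_smul, ← zpow_neg, mapA_zpow_smul,
      mapA_zpow_smul, mapB_smul_of_mem]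
    · rw [hq]; push_cast; field_simp; ring
    · have := Int.floor_le q; push_cast; linarith
    · have := Int.lt_floor_add_one q; push_cast; linarith

theorem exists_smul_zero_mem_Ioo {p q : ℝ} (hpq : p < q) :
    ∃ g ∈ ThompsonF, g • (0 : ℝ) ∈ Set.Ioo p q := by
  obtain ⟨k, hk⟩ := exists_pow_lt_of_lt_one (sub_pos.2 hpq) (by norm_num : (1 / 2 : ℝ) < 1)
  obtain ⟨g, hg, hg0⟩ := exists_smul_zero_eq_dyadic k (⌊p * 2 ^ k⌋ + 1)
  refine ⟨g, hg, ?_⟩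
  rw [hg0]
  have h2 : (0 : ℝ) < 2 ^ k := by positivity
  rw [one_div, inv_pow, inv_lt_iff_one_lt_mul₀ h2] at hk
  have h3 := Int.floor_le (p * 2 ^ k)
  have h4 := Int.lt_floor_add_one (p * 2 ^ k)
  push_cast
  constructor
  · rw [lt_div_iff₀ h2]; exact h4
  · rw [div_lt_iff₀ h2]; nlinarith

/-- Thompson's group moves every compact set into every nonempty open interval. -/
theorem exists_thompsonF_contracting (u v : ℝ) {p q : ℝ} (hpq : p < q) :
    ∃ f ∈ ThompsonF, ∀ t ∈ Set.Icc u v, f • t ∈ Set.Ioo p q := by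
  obtain ⟨g, hg, hgp, hgq⟩ := exists_smul_zero_mem_Ioo hpq
  set e : ℝ := g⁻¹ • q with he
  have he0 : 0 < e := by rwa [he, homeo_lt_inv_smul]
  obtain ⟨j, hj⟩ := exists_nat_gt (-u)
  obtain ⟨n, hn⟩ := exists_lt_pow_smul mapB (t := e) (s := v + j)
    fun r hr => lt_mapB_smul (he0.trans_le hr.1)
  have hb0 : (mapB ^ n)⁻¹ • (0 : ℝ) = 0 := by
    have h1 : mapB ∈ MulAction.stabilizer HomeoPlus (0 : ℝ) := mapB_smul_of_nonpos le_rfl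
    exact inv_mem (pow_mem h1 n)
  -- `aʲ` moves `[u, v]` right of `0`, `b⁻ⁿ` shrinks it into `(0, e)` while fixing `0`, and `g`
  -- carries `(0, e)` into `(p, q)`.
  refine ⟨g * (mapB ^ n)⁻¹ * mapA ^ j, mul_mem (mul_mem hg
    (inv_mem (pow_mem mapB_mem_thompsonF n))) (pow_mem mapA_mem_thompsonF j), fun t ht => ?_⟩
  simp only [mul_smul]
  rw [mapA_pow_smul]
  constructor
  · refine hgp.trans ?_
    rw [homeo_smul_lt_smul, ← hb0, homeo_smul_lt_smul]
    linarith [ht.1]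
  · rw [← homeo_lt_inv_smul, homeo_inv_smul_lt]
    linarith [ht.2]

end Contraction

/-! ### Simplicity of the commutator subgroup -/

section Simple

/-- The homeomorphisms with bounded support. -/
def boundedSupp : Subgroup HomeoPlus where
  carrier := {f | ∃ u v : ℝ, ∀ t, t ≤ u ∨ v ≤ t → f • t = t}
  one_mem' := ⟨0, 0, fun t _ => one_smul _ t⟩
  mul_mem' := by
    rintro f g ⟨u, v, h⟩ ⟨u', v', h'⟩
    refine ⟨min u u', max v v', fun t ht => ?_⟩
    rw [mul_smul, h' t, h t]
    · exact ht.imp (fun h => h.trans (min_le_left _ _)) fun h => (le_max_left _ _).trans h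
    · exact ht.imp (fun h => h.trans (min_le_right _ _)) fun h => (le_max_right _ _).trans h
  inv_mem' := by
    rintro f ⟨u, v, h⟩
    exact ⟨u, v, fun t ht => by rw [inv_smul_eq_iff, h t ht]⟩

instance : boundedSupp.Normal where
  conj_mem := by
    rintro f ⟨u, v, h⟩ g
    refine ⟨g • u, g • v, fun t ht => ?_⟩
    rw [mul_smul, mul_smul, h, smul_inv_smul]
    rwa [homeo_inv_smul_le, homeo_le_inv_smul]

theorem commutator_closure_le {Γ : Type*} [Group Γ] {S : Set Γ} {N : Subgroup Γ}
    (hN : ∀ g ∈ Subgroup.closure S, ∀ n ∈ N, g * n * g⁻¹ ∈ N)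
    (hS : ∀ s ∈ S, ∀ t ∈ S, ⁅s, t⁆ ∈ N) :
    ⁅Subgroup.closure S, Subgroup.closure S⁆ ≤ N := by
  have key : ∀ t, (∀ s ∈ S, ⁅s, t⁆ ∈ N) → ∀ x ∈ Subgroup.closure S, ⁅x, t⁆ ∈ N := by
    intro t ht x hx
    induction hx using Subgroup.closure_induction with
    | mem x hx => exact ht x hx
    | one => rw [commutatorElement_one_left]; exact one_mem _
    | mul x y hx hy ihx ihy =>
      have : ⁅x * y, t⁆ = x * ⁅y, t⁆ * x⁻¹ * ⁅x, t⁆ := by simp only [commutatorElement_def]; group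
      rw [this]
      exact mul_mem (hN x hx _ ihy) ihx
    | inv x hx ih =>
      have : ⁅x⁻¹, t⁆ = x⁻¹ * ⁅x, t⁆⁻¹ * x⁻¹⁻¹ := by simp only [commutatorElement_def]; group
      rw [this]
      exact hN _ (inv_mem hx) _ (inv_mem ih)
  rw [Subgroup.commutator_le]
  intro x hx y hy
  refine key y (fun s hs => ?_) x hx
  rw [← inv_mem_iff, commutatorElement_inv]
  refine key s (fun t ht => hS t ht s hs) y hy

/-- Higman's criterion: a nontrivial perfect group of homeomorphisms with bounded supports that
moves every compact set into every open interval is simple. -/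
theorem isSimpleGroup_of_contracting {D : Subgroup HomeoPlus} (hb : D ≤ boundedSupp)
    (hne : D ≠ ⊥) (hperf : D ≤ ⁅D, D⁆)
    (hcon : ∀ u v p q : ℝ, p < q → ∃ c ∈ D, ∀ t ∈ Set.Icc u v, c • t ∈ Set.Ioo p q) :
    IsSimpleGroup D := by
  have : Nontrivial D := (Subgroup.nontrivial_iff_ne_bot D).2 hne
  refine ⟨fun N hN => ?_⟩
  rw [or_iff_not_imp_left]
  intro hNne
  obtain ⟨⟨x, hxD⟩, hxN, hx1⟩ := (Subgroup.bot_or_exists_ne_one N).resolve_left hNne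
  have hx1' : x ≠ 1 := fun h => hx1 (Subtype.ext h)
  obtain ⟨p, q, hpq, hdisj⟩ : ∃ p q : ℝ, p < q ∧ ∀ s ∈ Set.Ioo p q, x • s ∉ Set.Ioo p q := by
    obtain ⟨t, ht⟩ : ∃ t : ℝ, x • t ≠ t := by
      by_contra! hc
      exact hx1' (homeo_ext fun t => by rw [hc t, one_smul])
    rcases ht.lt_or_gt with h | h
    · exact ⟨x • t, t, h, fun s hs hs' => by
        have := (homeo_smul_lt_smul x).2 hs.2
        exact lt_asymm this hs'.1⟩
    · exact ⟨t, x • t, h, fun s hs hs' => by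
        have := (homeo_smul_lt_smul x).2 hs.1
        exact lt_asymm this hs'.2⟩
  have hcomm : ⁅D, D⁆ ≤ N.map D.subtype := by
    rw [Subgroup.commutator_le]
    intro f hf g hg
    obtain ⟨u, v, hfu⟩ := hb hf
    obtain ⟨u', v', hgu⟩ := hb hg
    obtain ⟨c, hc, hcI⟩ := hcon (min u u') (max v v') p q hpq
    -- `x` displaces `(p, q)`, so this conjugate displaces a compact interval carrying both `f` and
    -- `g`.
    let y : D := ⟨c, hc⟩⁻¹ * ⟨x, hxD⟩ * ⟨c, hc⟩⁻¹⁻¹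
    have hy : y ∈ N := hN.conj_mem _ hxN _
    have hysep : ∀ t ∈ Set.Icc (min u u') (max v v'),
        (y : HomeoPlus) • t ∉ Set.Icc (min u u') (max v v') := by
      intro t ht ht'
      refine hdisj _ (hcI t ht) ?_
      have := hcI _ ht'
      simpa [y, mul_smul] using this
    have hfix : ∀ {w : HomeoPlus} {a b : ℝ}, min u u' ≤ a → b ≤ max v v' →
        (∀ t, t ≤ a ∨ b ≤ t → w • t = t) →
        ∀ t ∉ Set.Icc (min u u') (max v v'), w • t = t := by
      intro w a b ha hb' hw t ht
      rw [Set.mem_Icc, not_and_or, not_le, not_le] at ht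
      exact hw t (ht.imp (fun h => by linarith) fun h => by linarith)
    have hf' := hfix (min_le_left _ _) (le_max_left _ _) hfu
    have hg' := hfix (min_le_right _ _) (le_max_right _ _) hgu
    have hcomm2 : Commute ((y : HomeoPlus) * f⁻¹ * (y : HomeoPlus)⁻¹) g := by
      set z : HomeoPlus := y.1
      set I := Set.Icc (min u u') (max v v')
      have hz : ∀ t ∈ I, (z * f⁻¹ * z⁻¹) • t = t := by
        intro t ht
        have : z⁻¹ • t ∉ I := fun h => hysep _ h (by rwa [smul_inv_smul])
        rw [mul_smul, mul_smul, inv_smul_eq_iff.2 (hf' _ this).symm, smul_inv_smul]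
      exact commute_of_fix hz hg'
    let F : D := ⟨f, hf⟩
    let G : D := ⟨g, hg⟩
    have hw : ⁅F, y⁆ ∈ N := by
      rw [commutatorElement_def]
      exact mul_mem (hN.conj_mem _ hy _) (inv_mem hy)
    -- `[f, y] = f · (y f⁻¹ y⁻¹)`, and the second factor commutes with `g`, so `[f, g] = [[f, y],
    -- g]`.
    have hw2 : ⁅⁅F, y⁆, G⁆ ∈ N := by
      have : ⁅⁅F, y⁆, G⁆ = ⁅F, y⁆ * (G * ⁅F, y⁆⁻¹ * G⁻¹) := by
        simp only [commutatorElement_def]; group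
      rw [this]
      exact mul_mem hw (hN.conj_mem _ (inv_mem hw) _)
    refine ⟨_, hw2, ?_⟩
    have e1 : (D.subtype ⁅⁅F, y⁆, G⁆) = ⁅f * ((y : HomeoPlus) * f⁻¹ * (y : HomeoPlus)⁻¹), g⁆ := by
      simp only [map_commutatorElement]
      congr 1
    rw [e1]
    set w := (y : HomeoPlus) * f⁻¹ * (y : HomeoPlus)⁻¹
    rw [commutatorElement_def, commutatorElement_def, mul_inv_rev, mul_assoc f w g, hcomm2.eq]
    group
  rw [eq_top_iff]
  intro d _
  obtain ⟨n, hn, hnd⟩ := hcomm (hperf d.2)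
  rwa [← Subtype.ext hnd]

variable {m : ℕ} (k : Fin m → HomeoPlus)

/-- If `s` is trivial left of `0`, then `[s, aⁿ]` is `s` times a map supported far to the right;
similarly on the other side. The generators `b` and `k i` are of the first kind, and `a = b · (b⁻¹
a)` with `b⁻¹ a` of the second. -/
theorem exists_commutator_eqOn (hk : ∀ i, ∀ t ∉ Set.Ioo (1 / 2 : ℝ) (3 / 4), k i • t = t)
    {f : HomeoPlus} (hf : f ∈ extGroup k) :
    ∀ u v : ℝ, ∃ f' ∈ ⁅extGroup k, extGroup k⁆, ∀ t ∈ Set.Icc u v, f' • t = f • t := by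
  have hright : ∀ s ∈ extGroup k, (∀ t ≤ (0 : ℝ), s • t = t) → ∀ u v : ℝ,
      ∃ f' ∈ ⁅extGroup k, extGroup k⁆, ∀ t ∈ Set.Icc u v, f' • t = s • t := by
    intro s hs hst u v
    obtain ⟨n, hn⟩ := exists_nat_gt v
    refine ⟨⁅s, mapA ^ n⁆, Subgroup.commutator_mem_commutator hs (pow_mem (mapA_mem k) n),
      fun t ht => ?_⟩
    rw [commutatorElement_def, mul_smul, mul_smul, mul_smul, mapA_pow_inv_smul,
      inv_smul_eq_iff.2 (hst (t - n) (by linarith [ht.2])).symm, mapA_pow_smul, sub_add_cancel]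
  have hleft : ∀ s ∈ extGroup k, (∀ t, (1 : ℝ) ≤ t → s • t = t) → ∀ u v : ℝ,
      ∃ f' ∈ ⁅extGroup k, extGroup k⁆, ∀ t ∈ Set.Icc u v, f' • t = s • t := by
    intro s hs hst u v
    obtain ⟨n, hn⟩ := exists_nat_gt (1 - u)
    refine ⟨⁅s, (mapA ^ n)⁻¹⁆,
      Subgroup.commutator_mem_commutator hs (inv_mem (pow_mem (mapA_mem k) n)), fun t ht => ?_⟩
    rw [commutatorElement_def, mul_smul, mul_smul, mul_smul, inv_inv, mapA_pow_smul,
      inv_smul_eq_iff.2 (hst (t + n) (by linarith [ht.1])).symm, mapA_pow_inv_smul,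
      add_sub_cancel_right]
  have hmul : ∀ f g : HomeoPlus,
      (∀ u v : ℝ, ∃ f' ∈ ⁅extGroup k, extGroup k⁆, ∀ t ∈ Set.Icc u v, f' • t = f • t) →
      (∀ u v : ℝ, ∃ f' ∈ ⁅extGroup k, extGroup k⁆, ∀ t ∈ Set.Icc u v, f' • t = g • t) →
      ∀ u v : ℝ, ∃ f' ∈ ⁅extGroup k, extGroup k⁆, ∀ t ∈ Set.Icc u v, f' • t = (f * g) • t := by
    intro f g hf hg u v
    obtain ⟨g', hg', eg⟩ := hg u v
    obtain ⟨f', hf', ef⟩ := hf (g • u) (g • v)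
    refine ⟨f' * g', mul_mem hf' hg', fun t ht => ?_⟩
    rw [mul_smul, mul_smul, eg t ht, ef]
    exact ⟨(homeo_smul_le_smul g).2 ht.1, (homeo_smul_le_smul g).2 ht.2⟩
  have hb := hright mapB (mapB_mem k) fun t ht => mapB_smul_of_nonpos ht
  induction hf using Subgroup.closure_induction with
  | mem s hs =>
    rcases hs with (rfl | rfl) | ⟨i, rfl⟩
    · have := hmul _ _ hb (hleft (mapB⁻¹ * mapA) (mul_mem (inv_mem (mapB_mem k)) (mapA_mem k))
        fun t ht => by
          rw [mul_smul, inv_smul_eq_iff, mapA_smul, mapB_smul_of_one_le ht])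
      rwa [mul_inv_cancel_left] at this
    · exact hb
    · exact hright _ (mem_extGroup k i) fun t ht => hk i t fun h => by linarith [h.1]
  | one => exact fun u v => ⟨1, one_mem _, fun t _ => rfl⟩
  | mul f g _ _ hf hg => exact hmul f g hf hg
  | inv f _ ih =>
    intro u v
    obtain ⟨f', hf', ef⟩ := ih (f⁻¹ • u) (f⁻¹ • v)
    refine ⟨f'⁻¹, inv_mem hf', fun t ht => ?_⟩
    rw [inv_smul_eq_iff, ef, smul_inv_smul]
    exact ⟨(homeo_smul_le_smul _).2 ht.1, (homeo_smul_le_smul _).2 ht.2⟩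

theorem commutator_mapA_mapB_mem_boundedSupp : ⁅mapA, mapB⁆ ∈ boundedSupp := by
  refine ⟨0, 3, fun t ht => ?_⟩
  rw [commutatorElement_def, mul_smul, mul_smul, mul_smul, mapA_inv_smul, mapA_smul]
  rcases ht with ht | ht
  · rw [inv_smul_eq_iff.2 (mapB_smul_of_nonpos ht).symm, mapB_smul_of_nonpos (by linarith)]; ring
  · have : mapB⁻¹ • t = t - 1 := by
      rw [inv_smul_eq_iff, mapB_smul_of_one_le (by linarith)]; ring
    rw [this, mapB_smul_of_one_le (by linarith)]; ring

/-- With `c = [a, b]` this reads `c ≡ c²` modulo any normal subgroup for which `a` and `b`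
centralise `c`, forcing `c` into that subgroup. -/
theorem mapB_conj_commutator :
    mapB * ⁅mapA, mapB⁆ * mapB⁻¹ = mapA * ⁅mapA, mapB⁆ * mapA⁻¹ * ⁅mapA, mapB⁆ := by
  have h := isThompsonPair_mapA_mapB.relations 1 2 (by norm_num)
  simp only [thompsonSeq, pow_zero, pow_one, one_mul, inv_one, mul_one] at h
  have h' : mapB * (mapA * mapB * mapA⁻¹) * mapB⁻¹ = mapA ^ 2 * mapB * (mapA ^ 2)⁻¹ := by
    rw [h]; group
  calc mapB * ⁅mapA, mapB⁆ * mapB⁻¹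
      = mapB * (mapA * mapB * mapA⁻¹) * mapB⁻¹ * mapB⁻¹ := by
        rw [commutatorElement_def]; group
    _ = mapA * ⁅mapA, mapB⁆ * mapA⁻¹ * ⁅mapA, mapB⁆ := by
        rw [h', commutatorElement_def, pow_two]; group

theorem commutator_mapA_mapB_ne_one : ⁅mapA, mapB⁆ ≠ 1 := by
  intro h
  rw [commutatorElement_eq_one_iff_mul_comm] at h
  have := congrArg (fun f : HomeoPlus => f • (0 : ℝ)) h
  simp only [mul_smul, mapB_smul_of_nonpos le_rfl, mapA_smul, zero_add,
    mapB_smul_of_one_le le_rfl] at this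
  norm_num at this

variable (hk : ∀ i, ∀ t ∉ Set.Ioo (1 / 2 : ℝ) (3 / 4), k i • t = t)
include hk

theorem mem_boundedSupp_of_fix (i : Fin m) : k i ∈ boundedSupp :=
  ⟨1 / 2, 3 / 4, fun t ht => hk i t fun h => by rcases ht with ht | ht <;> linarith [h.1, h.2]⟩

/-- Among the generators only `a` and `b` have unbounded support, and these two commute near both
ends of the line. -/
theorem commutator_extGroup_le_boundedSupp : ⁅extGroup k, extGroup k⁆ ≤ boundedSupp := by
  have hN : boundedSupp.Normal := inferInstance
  have hl : ∀ {f g : HomeoPlus}, f ∈ boundedSupp → ⁅f, g⁆ ∈ boundedSupp := by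
    intro f g hf
    have : ⁅f, g⁆ = f * (g * f⁻¹ * g⁻¹) := by simp only [commutatorElement_def]; group
    rw [this]
    exact mul_mem hf (hN.conj_mem _ (inv_mem hf) _)
  have hr : ∀ {f g : HomeoPlus}, g ∈ boundedSupp → ⁅f, g⁆ ∈ boundedSupp := by
    intro f g hg
    rw [← inv_mem_iff, commutatorElement_inv]
    exact hl hg
  refine commutator_closure_le (fun g _ n hn => hN.conj_mem n hn g) ?_
  rintro s ((rfl | rfl) | ⟨i, rfl⟩) t ht
  · rcases ht with ((rfl | rfl) | ⟨j, rfl⟩)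
    · rw [commutatorElement_self]; exact one_mem _
    · exact commutator_mapA_mapB_mem_boundedSupp
    · exact hr (mem_boundedSupp_of_fix k hk j)
  · rcases ht with ((rfl | rfl) | ⟨j, rfl⟩)
    · rw [← inv_mem_iff, commutatorElement_inv]; exact commutator_mapA_mapB_mem_boundedSupp
    · rw [commutatorElement_self]; exact one_mem _
    · exact hr (mem_boundedSupp_of_fix k hk j)
  · exact hl (mem_boundedSupp_of_fix k hk i)

theorem exists_commutator_commutator_eq {f c : HomeoPlus} (hf : f ∈ extGroup k)
    (hc : c ∈ boundedSupp) : ∃ f' ∈ ⁅extGroup k, extGroup k⁆, ⁅f, c⁆ = ⁅f', c⁆ := by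
  obtain ⟨u, v, huv⟩ := hc
  obtain ⟨f', hf', e⟩ := exists_commutator_eqOn k hk hf u v
  refine ⟨f', hf', ?_⟩
  have hcom : Commute (f'⁻¹ * f) c := by
    have hfix : ∀ t ∈ Set.Icc u v, (f'⁻¹ * f) • t = t := fun t ht => by
      rw [mul_smul, inv_smul_eq_iff, e t ht]
    have hfix' : ∀ t, t ∉ Set.Icc u v → c • t = t := by
      intro t ht
      rw [Set.mem_Icc, not_and_or, not_le, not_le] at ht
      exact huv t (ht.imp le_of_lt le_of_lt)
    exact commute_of_fix hfix hfix'
  have hf2 : f = f' * (f'⁻¹ * f) := by group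
  rw [hf2]
  set z := f'⁻¹ * f
  rw [commutatorElement_def, commutatorElement_def, mul_inv_rev, mul_assoc f' z c, hcom.eq]
  group

/-- In `[f, c]` with `c` of bounded support, `f` may be replaced by an element of `D`. Applied once,
this puts `[Λ, D]` into `[D, D]`; applied to a bounded `c ∈ Λ`, it first gives `[f', c]` with `f' ∈
D`, which is of the former kind. Only `[a, b]` needs the extra relation. -/
theorem commutator_extGroup_perfect :
    ⁅extGroup k, extGroup k⁆ ≤ ⁅⁅extGroup k, extGroup k⁆, ⁅extGroup k, extGroup k⁆⁆ := by
  set Λ := extGroup k with hΛ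
  set D := ⁅Λ, Λ⁆ with hD
  have hDL : D ≤ Λ := Subgroup.commutator_le_self Λ
  have hDb : D ≤ boundedSupp := commutator_extGroup_le_boundedSupp k hk
  have hconjD : ∀ g ∈ Λ, ∀ n ∈ D, g * n * g⁻¹ ∈ D := by
    intro g hg n hn
    have h1 : ⁅g, n⁆ ∈ D := Subgroup.commutator_mem_commutator hg (hDL hn)
    have : g * n * g⁻¹ = ⁅g, n⁆ * n := by rw [commutatorElement_def]; group
    rw [this]; exact mul_mem h1 hn
  have hLD : ∀ f ∈ Λ, ∀ c ∈ D, ⁅f, c⁆ ∈ ⁅D, D⁆ := by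
    intro f hf c hc
    obtain ⟨f', hf', e⟩ := exists_commutator_commutator_eq k hk hf (hDb hc)
    rw [e]; exact Subgroup.commutator_mem_commutator hf' hc
  have hLb : ∀ f ∈ Λ, ∀ c ∈ Λ, c ∈ boundedSupp → ⁅f, c⁆ ∈ ⁅D, D⁆ := by
    intro f hf c hc hcb
    obtain ⟨f', hf', e⟩ := exists_commutator_commutator_eq k hk hf hcb
    rw [e, ← inv_mem_iff, commutatorElement_inv]
    exact hLD c hc f' hf'
  have hbL : ∀ c ∈ Λ, c ∈ boundedSupp → ∀ f ∈ Λ, ⁅c, f⁆ ∈ ⁅D, D⁆ := by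
    intro c hc hcb f hf
    rw [← inv_mem_iff, commutatorElement_inv]
    exact hLb f hf c hc hcb
  have hab : ⁅mapA, mapB⁆ ∈ ⁅D, D⁆ := by
    have hc : ⁅mapA, mapB⁆ ∈ D :=
      Subgroup.commutator_mem_commutator (mapA_mem k) (mapB_mem k)
    have h1 := hLD _ (mapA_mem k) _ hc
    have h2 := hLD _ (mapB_mem k) _ hc
    have h3 := mapB_conj_commutator
    have h4 : ⁅mapA, mapB⁆ = ⁅mapA, ⁅mapA, mapB⁆⁆⁻¹ * ⁅mapB, ⁅mapA, mapB⁆⁆ := by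
      rw [commutatorElement_def mapB ⁅mapA, mapB⁆, h3, commutatorElement_def mapA ⁅mapA, mapB⁆]
      group
    rw [h4]; exact mul_mem (inv_mem h1) h2
  refine commutator_closure_le (fun g hg n hn => ?_) ?_
  · have h1 := hLD g hg n (Subgroup.commutator_le_self D hn)
    have : g * n * g⁻¹ = ⁅g, n⁆ * n := by rw [commutatorElement_def]; group
    rw [this]; exact mul_mem h1 hn
  · rintro s ((rfl | rfl) | ⟨i, rfl⟩) t ht
    · rcases ht with ((rfl | rfl) | ⟨j, rfl⟩)
      · rw [commutatorElement_self]; exact one_mem _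
      · exact hab
      · exact hLb _ (mapA_mem k) _ (mem_extGroup k j) (mem_boundedSupp_of_fix k hk j)
    · rcases ht with ((rfl | rfl) | ⟨j, rfl⟩)
      · rw [← inv_mem_iff, commutatorElement_inv]; exact hab
      · rw [commutatorElement_self]; exact one_mem _
      · exact hLb _ (mapB_mem k) _ (mem_extGroup k j) (mem_boundedSupp_of_fix k hk j)
    · exact hbL _ (mem_extGroup k i) (mem_boundedSupp_of_fix k hk i) _
        (Subgroup.subset_closure ht)

theorem isSimpleGroup_commutator_extGroup : IsSimpleGroup (commutator (extGroup k)) := by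
  have h : IsSimpleGroup (⁅extGroup k, extGroup k⁆ : Subgroup HomeoPlus) := by
    refine isSimpleGroup_of_contracting (commutator_extGroup_le_boundedSupp k hk) ?_
      (commutator_extGroup_perfect k hk) ?_
    · intro hbot
      have := Subgroup.commutator_mem_commutator (mapA_mem k) (mapB_mem k)
      rw [hbot, Subgroup.mem_bot] at this
      exact commutator_mapA_mapB_ne_one this
    · intro u v p q hpq
      obtain ⟨f, hf, hfI⟩ := exists_thompsonF_contracting u v hpq
      obtain ⟨f', hf', e⟩ := exists_commutator_eqOn k hk (thompsonF_le k hf) u v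
      exact ⟨f', hf', fun t ht => by rw [e t ht]; exact hfI t ht⟩
  rw [← Subgroup.map_subtype_commutator] at h
  exact (((commutator (extGroup k)).equivMapOfInjective _
    (extGroup k).subtype_injective).isSimpleGroup_congr).2 h

end Simple

/-! ### Conjugating one-bump maps -/

section Models

theorem zpow_smul_mem_Ioo {h : HomeoPlus} {x y : ℝ} (hx : h • x = x) (hy : h • y = y) (n : ℤ)
    {t : ℝ} (ht : t ∈ Set.Ioo x y) : h ^ n • t ∈ Set.Ioo x y := by
  have hx' : h ∈ MulAction.stabilizer HomeoPlus x := hx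
  have hy' : h ∈ MulAction.stabilizer HomeoPlus y := hy
  have hx2 : h ^ n • x = x := zpow_mem hx' n
  have hy2 : h ^ n • y = y := zpow_mem hy' n
  constructor
  · rw [← hx2, homeo_smul_lt_smul]; exact ht.1
  · rw [← hy2, homeo_smul_lt_smul]; exact ht.2

/-- A homeomorphism moving every point of `(x, y)` to the right is conjugate there to a
translation. -/
theorem exists_translation_model {h : HomeoPlus} {x y : ℝ} (hxy : x < y) (hx : h • x = x)
    (hy : h • y = y) (hpos : ∀ t ∈ Set.Ioo x y, t < h • t) :
    ∃ H : ℝ → ℝ, StrictMono H ∧ Set.range H = Set.Ioo x y ∧ ∀ s, H (s + 1) = h • H s := by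
  obtain ⟨t₀, ht₀⟩ := exists_between hxy
  have hI : ∀ (n : ℤ) {t : ℝ}, t ∈ Set.Ioo x y → h ^ n • t ∈ Set.Ioo x y :=
    fun n t ht => zpow_smul_mem_Ioo hx hy n ht
  have h1 : t₀ < h • t₀ := hpos t₀ ht₀
  have hht₀ : h • t₀ ∈ Set.Ioo x y := by simpa using hI 1 ht₀
  have hmono : StrictMono fun n : ℤ => h ^ n • t₀ := by
    refine strictMono_int_of_lt_succ fun n => ?_
    rw [zpow_add_one, mul_smul, homeo_smul_lt_smul]; exact h1
  -- Affine on the fundamental domain `[t₀, h t₀)`, extended equivariantly.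
  set H : ℝ → ℝ := fun s => h ^ ⌊s⌋ • (t₀ + Int.fract s * (h • t₀ - t₀)) with hH
  have hlow : ∀ s, h ^ ⌊s⌋ • t₀ ≤ H s := fun s => by
    rw [hH, homeo_smul_le_smul]
    nlinarith [Int.fract_nonneg s]
  have hup : ∀ s, H s < h ^ (⌊s⌋ + 1) • t₀ := fun s => by
    rw [hH, zpow_add_one, mul_smul, homeo_smul_lt_smul]
    nlinarith [Int.fract_lt_one s]
  refine ⟨H, fun s s' hss => ?_, ?_, fun s => ?_⟩
  · rcases (Int.floor_mono hss.le).lt_or_eq with hlt | heq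
    · exact (hup s).trans_le ((hmono.monotone (Int.add_one_le_iff.2 hlt)).trans (hlow s'))
    · simp only [hH]
      rw [heq, homeo_smul_lt_smul]
      have : Int.fract s < Int.fract s' := by
        rw [Int.fract, Int.fract, heq]; linarith
      nlinarith
  · ext t
    constructor
    · rintro ⟨s, rfl⟩
      exact ⟨(hI _ ht₀).1.trans_le (hlow s), (hup s).trans (hI _ ht₀).2⟩
    · intro ht
      obtain ⟨n, hn, hmax⟩ := Int.exists_greatest_of_bdd (P := fun n => h ^ n • t₀ ≤ t)
        (by
          obtain ⟨N, hN⟩ := exists_lt_pow_smul h (t := t₀) (s := t)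
            fun r hr => hpos r ⟨ht₀.1.trans_le hr.1, hr.2.trans_lt ht.2⟩
          refine ⟨N, fun z hz => ?_⟩
          rw [← hmono.le_iff_le]
          simp only [zpow_natCast]
          exact hz.trans hN.le)
        (by
          obtain ⟨N, hN⟩ := exists_lt_pow_smul h (t := t) (s := t₀)
            fun r hr => hpos r ⟨ht.1.trans_le hr.1, hr.2.trans_lt ht₀.2⟩
          refine ⟨-N, ?_⟩
          rw [zpow_neg, homeo_inv_smul_le, zpow_natCast]
          exact hN.le)
      have hn' : t < h ^ (n + 1) • t₀ := by
        by_contra! hc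
        have := hmax _ hc
        omega
      set u : ℝ := (h ^ n)⁻¹ • t with hu
      have hu1 : t₀ ≤ u := by rwa [hu, homeo_le_inv_smul]
      have hu2 : u < h • t₀ := by rwa [hu, homeo_inv_smul_lt, ← mul_smul, ← zpow_add_one]
      have hd : 0 < h • t₀ - t₀ := by linarith
      have hr : (u - t₀) / (h • t₀ - t₀) ∈ Set.Ico (0 : ℝ) 1 :=
        ⟨div_nonneg (by linarith) hd.le, by rw [div_lt_one hd]; linarith⟩
      refine ⟨n + (u - t₀) / (h • t₀ - t₀), ?_⟩
      simp only [hH]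
      rw [Int.floor_intCast_add, Int.fract_intCast_add, Int.floor_eq_zero_iff.2 hr,
        Int.fract_eq_self.2 hr, add_zero, div_mul_cancel₀ _ hd.ne', add_sub_cancel, hu,
        smul_inv_smul]
  · simp only [hH]
    rw [Int.floor_add_one, Int.fract_add_one, ← mul_smul, zpow_add_one,
      (Commute.zpow_self h _).eq]

theorem exists_homeo_extending {x y p q : ℝ} (hxy : x < y) (hpq : p < q) (g : ℝ → ℝ)
    (hg : StrictMonoOn g (Set.Ioo x y)) (himg : g '' Set.Ioo x y = Set.Ioo p q) :
    ∃ ψ : HomeoPlus, ψ • x = p ∧ ψ • y = q ∧ ∀ t ∈ Set.Ioo x y, ψ • t = g t := by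
  set f : ℝ → ℝ := fun t => if t ≤ x then t - x + p else if t < y then g t else t - y + q with hf
  have hgm : ∀ t, x < t → t < y → p < g t ∧ g t < q := fun t h1 h2 => by
    have : g t ∈ Set.Ioo p q := himg ▸ Set.mem_image_of_mem g ⟨h1, h2⟩
    exact this
  have hmono : StrictMono f := by
    intro s t hst
    simp only [hf]
    split_ifs with h1 h2 h3 h4 h5 h6
    · linarith
    · linarith [hgm t (by linarith) h3]
    · linarith
    · linarith
    · exact hg ⟨by linarith, h4⟩ ⟨by linarith, h6⟩ hst
    · linarith [hgm s (by linarith) h4]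
    · linarith
    · linarith
    · linarith
  have hsurj : Function.Surjective f := by
    intro z
    by_cases h1 : z ≤ p
    · exact ⟨z - p + x, by simp only [hf]; rw [if_pos (by linarith)]; ring⟩
    by_cases h2 : z < q
    · obtain ⟨t, ht, rfl⟩ : z ∈ g '' Set.Ioo x y := himg ▸ ⟨not_le.1 h1, h2⟩
      exact ⟨t, by simp only [hf]; rw [if_neg (not_le.2 ht.1), if_pos ht.2]⟩
    · refine ⟨z - q + y, ?_⟩
      simp only [hf]; rw [if_neg (by linarith), if_neg (by linarith)]; ring
  refine ⟨ofStrictMono f hmono hsurj, ?_, ?_, fun t ht => ?_⟩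
  · simp [hf]
  · simp only [ofStrictMono_smul, hf]; rw [if_neg (by linarith), if_neg (by linarith)]; ring
  · simp only [ofStrictMono_smul, hf]; rw [if_neg (not_le.2 ht.1), if_pos ht.2]

theorem exists_homeo_glue {ψ₁ ψ₂ : HomeoPlus} {y : ℝ} (h : ψ₁ • y = ψ₂ • y) :
    ∃ ψ : HomeoPlus, (∀ t ≤ y, ψ • t = ψ₁ • t) ∧ ∀ t, y ≤ t → ψ • t = ψ₂ • t := by
  set f : ℝ → ℝ := fun t => if t ≤ y then ψ₁ • t else ψ₂ • t with hf
  have hmono : StrictMono f := by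
    intro s t hst
    simp only [hf]
    split_ifs with h1 h2
    · simpa
    · calc ψ₁ • s ≤ ψ₁ • y := by simpa
        _ = ψ₂ • y := h
        _ < ψ₂ • t := by simpa using h2
    · linarith
    · simpa
  have hsurj : Function.Surjective f := by
    intro z
    by_cases hz : z ≤ ψ₁ • y
    · refine ⟨ψ₁⁻¹ • z, ?_⟩
      simp only [hf]
      rw [if_pos (by rwa [homeo_inv_smul_le]), smul_inv_smul]
    · refine ⟨ψ₂⁻¹ • z, ?_⟩
      simp only [hf]
      rw [if_neg (by rwa [homeo_inv_smul_le, ← h]), smul_inv_smul]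
  refine ⟨ofStrictMono f hmono hsurj, fun t ht => ?_, fun t ht => ?_⟩
  · simp only [ofStrictMono_smul, hf]; rw [if_pos ht]
  · simp only [ofStrictMono_smul, hf]
    rcases ht.eq_or_lt with rfl | ht
    · rw [if_pos le_rfl, h]
    · rw [if_neg (not_le.2 ht)]

/-- Two homeomorphisms without fixed points on intervals, both moving points to the right, are
conjugate on these intervals. -/
theorem exists_conj_of_lt {h v : HomeoPlus} {x y p q : ℝ} (hxy : x < y) (hpq : p < q)
    (hx : h • x = x) (hy : h • y = y) (hpos : ∀ t ∈ Set.Ioo x y, t < h • t)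
    (hp : v • p = p) (hq : v • q = q) (vpos : ∀ t ∈ Set.Ioo p q, t < v • t) :
    ∃ ψ : HomeoPlus, ψ • x = p ∧ ψ • y = q ∧ ∀ t ∈ Set.Icc x y, ψ • h • t = v • ψ • t := by
  obtain ⟨H, hH, hHr, hHs⟩ := exists_translation_model hxy hx hy hpos
  obtain ⟨K, hK, hKr, hKs⟩ := exists_translation_model hpq hp hq vpos
  have hinv : ∀ s, Function.invFun H (H s) = s := Function.leftInverse_invFun hH.injective
  obtain ⟨ψ, hψx, hψy, hψ⟩ := exists_homeo_extending hxy hpq (fun t => K (Function.invFun H t))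
    (by
      rw [← hHr]
      rintro _ ⟨s, rfl⟩ _ ⟨t, rfl⟩ hst
      simp only [hinv]
      exact hK (hH.lt_iff_lt.1 hst))
    (by
      rw [← hHr, ← hKr, ← Set.range_comp]
      congr 1
      funext s
      simp only [Function.comp, hinv])
  refine ⟨ψ, hψx, hψy, fun t ht => ?_⟩
  rcases ht.1.eq_or_lt with rfl | h1
  · rw [hx, hψx, hp]
  rcases ht.2.eq_or_lt with rfl | h2
  · rw [hy, hψy, hq]
  obtain ⟨s, rfl⟩ : t ∈ Set.range H := hHr ▸ ⟨h1, h2⟩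
  have hmem : ∀ s, H s ∈ Set.Ioo x y := fun s => hHr ▸ ⟨s, rfl⟩
  rw [← hHs, hψ _ (hmem _), hψ _ (hmem _), hinv, hinv, hKs]

/-- The middle map of the unperturbed three-chain has support `(0, 2)`; translate it by `2i`. -/
theorem exists_thompsonF_bump (i : ℤ) : ∃ v ∈ ThompsonF,
    (∀ t ∈ Set.Ioo (2 * i : ℝ) (2 * i + 2), t < v • t) ∧
      ∀ t : ℝ, t ≤ 2 * i ∨ 2 * i + 2 ≤ t → v • t = t := by
  have hκ : ∀ _ : ℕ, ∀ t ∉ Set.Ioo (1 / 2 : ℝ) (3 / 4), (1 : HomeoPlus) • t = t :=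
    fun _ t _ => one_smul _ t
  have hc : chainMap 1 (fun _ => 1) 1 ∈ ThompsonF := by
    have hA := mapA_mem_thompsonF
    have hB := mapB_mem_thompsonF
    simp only [chainMap, chainB, le_refl, if_true, zero_le, pow_one, pow_zero, one_mul, mul_one,
      inv_one]
    exact mul_mem (inv_mem (mul_mem (mul_mem hA hB) (inv_mem hA))) hB
  have hA := zpow_mem mapA_mem_thompsonF (2 * i)
  have hsm : ∀ t : ℝ, (mapA ^ (2 * i) * chainMap 1 (fun _ => 1) 1 * (mapA ^ (2 * i))⁻¹) • t =
      chainMap 1 (fun _ => 1) 1 • (t - 2 * i) + 2 * i := by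
    intro t
    rw [mul_smul, mul_smul, ← zpow_neg, mapA_zpow_smul, mapA_zpow_smul]
    push_cast
    rfl
  refine ⟨_, mul_mem (mul_mem hA hc) (inv_mem hA), fun t ht => ?_, fun t ht => ?_⟩
  · rw [hsm]
    have := lt_chainMap_smul hκ (i := 1) (m := 1) (t := t - 2 * i) (by omega)
      (Or.inr (by push_cast; linarith [ht.1])) (Or.inr (by push_cast; linarith [ht.2]))
    linarith
  · rw [hsm]
    rcases ht with ht | ht
    · rw [chainMap_smul_of_le hκ (by omega) (by push_cast; linarith)]; ring
    · rw [chainMap_smul_of_ge hκ (by omega) (by push_cast; linarith)]; ring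

end Models

/-! ### Finitely many components: conjugation into `F` -/

section Finite

/-- `h` is conjugate on `[x, y]` to an element of Thompson's group supported in some `[2i, 2N]`,
for every prescribed left endpoint `2i`. -/
def ConjToThompson (h : HomeoPlus) (x y : ℝ) : Prop :=
  ∀ i : ℤ, ∃ N : ℤ, i < N ∧ ∃ ψ : HomeoPlus, ∃ v ∈ ThompsonF,
    (∀ t : ℝ, t ≤ 2 * i ∨ 2 * N ≤ t → v • t = t) ∧ ψ • x = 2 * i ∧ ψ • y = 2 * N ∧
      ∀ t ∈ Set.Icc x y, ψ • h • t = v • ψ • t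

variable {h : HomeoPlus} {x y z : ℝ}

theorem conjToThompson_of_lt (hxy : x < y) (hx : h • x = x) (hy : h • y = y)
    (hpos : ∀ t ∈ Set.Ioo x y, t < h • t) : ConjToThompson h x y := by
  intro i
  obtain ⟨v, hv, hvpos, hvfix⟩ := exists_thompsonF_bump i
  have e : (2 * ((i + 1 : ℤ) : ℝ)) = 2 * i + 2 := by push_cast; ring
  obtain ⟨ψ, h1, h2, h3⟩ := exists_conj_of_lt hxy (by linarith : (2 * i : ℝ) < 2 * i + 2) hx hy hpos
    (hvfix _ (Or.inl le_rfl)) (hvfix _ (Or.inr le_rfl)) hvpos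
  exact ⟨i + 1, by omega, ψ, v, hv, by rwa [e], h1, by rwa [e], h3⟩

theorem conjToThompson_of_fix (hxy : x < y) (hfix : ∀ t ∈ Set.Icc x y, h • t = t) :
    ConjToThompson h x y := by
  intro i
  have e : (2 * ((i + 1 : ℤ) : ℝ)) = 2 * i + 2 := by push_cast; ring
  have hc : 0 < 2 / (y - x) := div_pos two_pos (by linarith)
  set f : ℝ → ℝ := fun t => (t - x) * (2 / (y - x)) + 2 * i with hf
  have hmono : StrictMono f := fun s t hst => by
    have := mul_lt_mul_of_pos_right (sub_lt_sub_right hst x) hc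
    simp only [hf]; linarith
  have hsurj : Function.Surjective f := fun z =>
    ⟨(z - 2 * i) / (2 / (y - x)) + x, by
      simp only [hf]; rw [add_sub_cancel_right, div_mul_cancel₀ _ hc.ne']; ring⟩
  refine ⟨i + 1, by omega, ofStrictMono f hmono hsurj, 1, one_mem _, fun t _ => one_smul _ t,
    ?_, ?_, fun t ht => ?_⟩
  · simp [hf]
  · rw [e, ofStrictMono_smul]
    simp only [hf]
    rw [mul_div_cancel₀ _ (by linarith : y - x ≠ 0)]; ring
  · rw [hfix t ht, one_smul]

theorem ConjToThompson.of_inv (hx : h • x = x) (hy : h • y = y)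
    (hinv : ConjToThompson h⁻¹ x y) : ConjToThompson h x y := by
  intro i
  obtain ⟨N, hN, ψ, v, hv, hvfix, h1, h2, h3⟩ := hinv i
  refine ⟨N, hN, ψ, v⁻¹, inv_mem hv, fun t ht => ?_, h1, h2, fun t ht => ?_⟩
  · rw [inv_smul_eq_iff, hvfix t ht]
  · have hm : h • t ∈ Set.Icc x y := by
      constructor
      · rw [← hx, homeo_smul_le_smul]; exact ht.1
      · rw [← hy, homeo_smul_le_smul]; exact ht.2
    have := h3 _ hm
    rw [inv_smul_smul] at this
    rw [this, inv_smul_smul]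

/-- Since the left endpoint of a model is free, the second model can start where the first ends, and
the conjugators glue. -/
theorem ConjToThompson.trans (hxy : x < y) (hyz : y < z) (hy : h • y = y)
    (h₁ : ConjToThompson h x y) (h₂ : ConjToThompson h y z) :
    ConjToThompson h x z := by
  intro i
  obtain ⟨M, hM, ψ₁, v₁, hv₁, hfix₁, hx₁, hy₁, hc₁⟩ := h₁ i
  obtain ⟨N, hN, ψ₂, v₂, hv₂, hfix₂, hy₂, hz₂, hc₂⟩ := h₂ M
  obtain ⟨ψ, hψ₁, hψ₂⟩ := exists_homeo_glue (hy₁.trans hy₂.symm)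
  have hiM : (i : ℝ) < M := by exact_mod_cast hM
  have hMN : (M : ℝ) < N := by exact_mod_cast hN
  refine ⟨N, hM.trans hN, ψ, v₁ * v₂, mul_mem hv₁ hv₂, fun t ht => ?_, ?_, ?_, fun t ht => ?_⟩
  · rw [mul_smul, hfix₂ t (ht.imp (fun h => by linarith) id),
      hfix₁ t (ht.imp id fun h => by linarith)]
  · rw [hψ₁ x hxy.le, hx₁]
  · rw [hψ₂ z hyz.le, hz₂]
  · rw [mul_smul]
    rcases le_total t y with hty | hty
    · have hht : h • t ≤ y := by rw [← hy, homeo_smul_le_smul]; exact hty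
      rw [hψ₁ _ hht, hψ₁ _ hty, hc₁ t ⟨ht.1, hty⟩, hfix₂ _ (Or.inl _)]
      rw [← hy₁, homeo_smul_le_smul]; exact hty
    · have hht : y ≤ h • t := by rw [← hy, homeo_smul_le_smul]; exact hty
      rw [hψ₂ _ hht, hψ₂ _ hty, hc₂ t ⟨hty, ht.2⟩, hfix₁ _ (Or.inr _)]
      rw [← hc₂ t ⟨hty, ht.2⟩, ← hy₂, homeo_smul_le_smul]; exact hht

theorem isOpen_supp (h : HomeoPlus) : IsOpen (supp h) :=
  isOpen_ne_fun (smul_continuous h) continuous_id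

/-- Split at boundary points of the support until none is left inside. By connectedness `h` is then
trivial on the interval or fixes none of its interior points, and in the latter case it moves all of
them in the same direction. -/
theorem conjToThompson_of_frontier (Z : Finset ℝ) : ∀ x y : ℝ, x < y → h • x = x → h • y = y →
    (∀ t ∈ Set.Ioo x y, t ∈ frontier (supp h) → t ∈ Z) → ConjToThompson h x y := by
  induction Z using Finset.strongInduction with
  | H Z ih =>
    intro x y hxy hx hy hZ
    by_cases hfr : ∃ t ∈ Set.Ioo x y, t ∈ frontier (supp h)
    · obtain ⟨t, ht, htf⟩ := hfr
      have hfix : h • t = t := by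
        rw [(isOpen_supp h).frontier_eq] at htf
        exact not_not.1 htf.2
      have hss := Finset.erase_ssubset (hZ t ht htf)
      refine ConjToThompson.trans ht.1 ht.2 hfix (ih _ hss _ _ ht.1 hx hfix ?_)
        (ih _ hss _ _ ht.2 hfix hy ?_)
      · intro s hs hsf
        exact Finset.mem_erase.2 ⟨hs.2.ne, hZ s ⟨hs.1, hs.2.trans ht.2⟩ hsf⟩
      · intro s hs hsf
        exact Finset.mem_erase.2 ⟨hs.1.ne', hZ s ⟨ht.1.trans hs.1, hs.2⟩ hsf⟩
    · push Not at hfr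
      by_cases hS : (Set.Ioo x y ∩ supp h).Nonempty
      · have hall : ∀ t ∈ Set.Ioo x y, h • t ≠ t := by
          intro t ht hc
          refine isPreconnected_Ioo.subset_left_of_subset_union (isOpen_supp h)
            isClosed_closure.isOpen_compl
            (Set.disjoint_compl_right_iff_subset.2 subset_closure) (fun s hs => ?_) hS ht hc
          by_cases hsS : s ∈ supp h
          · exact Or.inl hsS
          · refine Or.inr fun hcl => hfr s hs ?_
            rw [(isOpen_supp h).frontier_eq]
            exact ⟨hcl, hsS⟩
        obtain ⟨s, hs, -⟩ := hS
        rcases (hall s hs).lt_or_gt with hlt | hgt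
        · refine ConjToThompson.of_inv hx hy (conjToThompson_of_lt hxy
            (by rw [inv_smul_eq_iff, hx]) (by rw [inv_smul_eq_iff, hy]) fun t ht => ?_)
          rw [homeo_lt_inv_smul]
          by_contra! hc
          obtain ⟨r, hr, hre⟩ := isPreconnected_Ioo.intermediate_value₂ hs ht
            (smul_continuous h).continuousOn continuousOn_id hlt.le hc
          exact hall r hr hre
        · refine conjToThompson_of_lt hxy hx hy fun t ht => ?_
          by_contra! hc
          obtain ⟨r, hr, hre⟩ := isPreconnected_Ioo.intermediate_value₂ ht hs
            (smul_continuous h).continuousOn continuousOn_id hc hgt.le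
          exact hall r hr hre
      · refine conjToThompson_of_fix hxy fun t ht => ?_
        rcases ht.1.eq_or_lt with rfl | h1
        · exact hx
        rcases ht.2.eq_or_lt with rfl | h2
        · exact hy
        by_contra hc
        exact hS ⟨t, ⟨h1, h2⟩, hc⟩

theorem mem_pair_of_mem_closure_diff {C : Set ℝ} (hC : C.OrdConnected) {t : ℝ}
    (ht : t ∈ closure C) (htC : t ∉ C) : t = sSup C ∨ t = sInf C := by
  have hne : C.Nonempty := closure_nonempty_iff.1 ⟨t, ht⟩
  by_cases h : t ∈ upperBounds C
  · exact Or.inl ((isLUB_of_mem_closure h ht).csSup_eq hne).symm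
  · right
    refine ((isGLB_of_mem_closure (fun c hc => ?_) ht).csInf_eq hne).symm
    rw [mem_upperBounds] at h
    push Not at h
    obtain ⟨d, hd, htd⟩ := h
    by_contra! hct
    exact htC (hC.out hc hd ⟨hct.le, htd.le⟩)

/-- With finitely many components, closure commutes with their union, so a boundary point is an
endpoint of one of them. For unbounded components a junk `sSup` or `sInf` only enlarges the finite
set. -/
theorem HasFinitelyManyComponents.frontier_finite {S : Set ℝ} (hS : IsOpen S)
    (hfin : HasFinitelyManyComponents S) : (frontier S).Finite := by
  have : Finite (ConnectedComponents S) := hfin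
  set C : ConnectedComponents S → Set ℝ := fun c =>
    Subtype.val '' ((fun x : S => (x : ConnectedComponents S)) ⁻¹' {c}) with hCdef
  have hU : S = ⋃ c, C c := by
    ext t
    simp only [hCdef, Set.mem_iUnion, Set.mem_image, Set.mem_preimage, Set.mem_singleton_iff]
    constructor
    · intro ht; exact ⟨_, ⟨t, ht⟩, rfl, rfl⟩
    · rintro ⟨_, s, _, rfl⟩; exact s.2
  have hC : ∀ c, (C c).OrdConnected := by
    intro c
    obtain ⟨s, rfl⟩ := ConnectedComponents.surjective_coe c
    refine IsPreconnected.ordConnected ?_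
    simp only [hCdef]
    rw [connectedComponents_preimage_singleton]
    exact isPreconnected_connectedComponent.image _ continuous_subtype_val.continuousOn
  refine ((Set.finite_range fun c => sSup (C c)).union
    (Set.finite_range fun c => sInf (C c))).subset fun t ht => ?_
  rw [hS.frontier_eq] at ht
  obtain ⟨ht1, ht2⟩ := ht
  rw [hU, closure_iUnion_of_finite, Set.mem_iUnion] at ht1
  obtain ⟨c, hc⟩ := ht1
  have hcS : t ∉ C c := fun h => ht2 (hU ▸ Set.mem_iUnion.2 ⟨c, h⟩)
  rcases mem_pair_of_mem_closure_diff (hC c) hc hcS with h | h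
  · exact Or.inl ⟨c, h.symm⟩
  · exact Or.inr ⟨c, h.symm⟩

/-- A homeomorphism supported in a bounded interval with only finitely many boundary points of
its support inside is conjugate to an element of Thompson's group. -/
theorem exists_conj_mem_thompsonF {u w : ℝ} (huw : u < w)
    (hfix : ∀ t ∉ Set.Ioo u w, h • t = t) (hfin : (Set.Ioo u w ∩ frontier (supp h)).Finite) :
    ∃ ψ : HomeoPlus, ψ * h * ψ⁻¹ ∈ ThompsonF := by
  obtain ⟨N, -, ψ, v, hv, hvfix, h1, h2, h3⟩ := conjToThompson_of_frontier hfin.toFinset u w huw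
    (hfix u (by simp)) (hfix w (by simp)) (fun t ht htf => by simpa using ⟨ht, htf⟩) 0
  refine ⟨ψ, ?_⟩
  have : ψ * h * ψ⁻¹ = v := by
    rw [mul_inv_eq_iff_eq_mul]
    refine homeo_ext fun t => ?_
    rw [mul_smul, mul_smul]
    by_cases ht : t ∈ Set.Icc u w
    · exact h3 t ht
    · rw [hfix t fun hc => ht ⟨hc.1.le, hc.2.le⟩, hvfix]
      rw [← h1, ← h2, homeo_smul_le_smul, homeo_smul_le_smul]
      rw [Set.mem_Icc, not_and_or, not_le, not_le] at ht
      exact ht.imp le_of_lt le_of_lt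
  rwa [this]

end Finite

/-! ### Copies of `Homeo⁺(ℝ)` on bounded intervals -/

section Extension

/-- An increasing open embedding of the line with image `(-1, 1)`. -/
noncomputable def intoIoo (s : ℝ) : ℝ := orderIsoIooNegOneOne ℝ s

theorem strictMono_intoIoo : StrictMono intoIoo := (orderIsoIooNegOneOne ℝ).strictMono

theorem intoIoo_mem (s : ℝ) : intoIoo s ∈ Set.Ioo (-1 : ℝ) 1 := (orderIsoIooNegOneOne ℝ s).2

theorem exists_intoIoo_eq {t : ℝ} (ht : t ∈ Set.Ioo (-1 : ℝ) 1) : ∃ s, intoIoo s = t :=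
  ⟨(orderIsoIooNegOneOne ℝ).symm ⟨t, ht⟩, by simp [intoIoo]⟩

theorem isOpenEmbedding_intoIoo : Topology.IsOpenEmbedding intoIoo :=
  isOpen_Ioo.isOpenEmbedding_subtypeVal.comp
    (orderIsoIooNegOneOne ℝ).toHomeomorph.isOpenEmbedding

/-- The extension by the identity of the copy of `h` on `(-1, 1)`. -/
noncomputable def extendFun (h : HomeoPlus) : ℝ → ℝ :=
  Function.extend intoIoo (fun s => intoIoo (h • s)) id

theorem extendFun_intoIoo (h : HomeoPlus) (s : ℝ) : extendFun h (intoIoo s) = intoIoo (h • s) :=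
  strictMono_intoIoo.injective.extend_apply _ _ _

theorem extendFun_of_notMem (h : HomeoPlus) {t : ℝ} (ht : t ∉ Set.Ioo (-1 : ℝ) 1) :
    extendFun h t = t :=
  Function.extend_apply' _ _ _ (by rintro ⟨s, rfl⟩; exact ht (intoIoo_mem s))

theorem strictMono_extendFun (h : HomeoPlus) : StrictMono (extendFun h) := by
  intro s t hst
  by_cases hs : s ∈ Set.Ioo (-1 : ℝ) 1 <;> by_cases ht : t ∈ Set.Ioo (-1 : ℝ) 1
  · obtain ⟨s, rfl⟩ := exists_intoIoo_eq hs
    obtain ⟨t, rfl⟩ := exists_intoIoo_eq ht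
    rw [extendFun_intoIoo, extendFun_intoIoo, strictMono_intoIoo.lt_iff_lt, homeo_smul_lt_smul]
    exact strictMono_intoIoo.lt_iff_lt.1 hst
  · obtain ⟨s, rfl⟩ := exists_intoIoo_eq hs
    rw [extendFun_intoIoo, extendFun_of_notMem h ht]
    have h1 : 1 ≤ t := by
      by_contra! hc
      exact ht ⟨hs.1.trans hst, hc⟩
    exact (intoIoo_mem _).2.trans_le h1
  · obtain ⟨t, rfl⟩ := exists_intoIoo_eq ht
    rw [extendFun_intoIoo, extendFun_of_notMem h hs]
    have h1 : s ≤ -1 := by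
      by_contra! hc
      exact hs ⟨hc, hst.trans ht.2⟩
    exact h1.trans_lt (intoIoo_mem _).1
  · rwa [extendFun_of_notMem h hs, extendFun_of_notMem h ht]

theorem surjective_extendFun (h : HomeoPlus) : Function.Surjective (extendFun h) := by
  intro t
  by_cases ht : t ∈ Set.Ioo (-1 : ℝ) 1
  · obtain ⟨t, rfl⟩ := exists_intoIoo_eq ht
    exact ⟨intoIoo (h⁻¹ • t), by rw [extendFun_intoIoo, smul_inv_smul]⟩
  · exact ⟨t, extendFun_of_notMem h ht⟩

/-- `Homeo⁺(ℝ)` as a group of homeomorphisms supported in `(-1, 1)`. -/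
noncomputable def extendHom : HomeoPlus →* HomeoPlus :=
  MonoidHom.mk'
    (fun h => ofStrictMono (extendFun h) (strictMono_extendFun h) (surjective_extendFun h)) (by
    intro f g
    refine homeo_ext fun t => ?_
    rw [mul_smul]
    simp only [ofStrictMono_smul]
    by_cases ht : t ∈ Set.Ioo (-1 : ℝ) 1
    · obtain ⟨t, rfl⟩ := exists_intoIoo_eq ht
      simp only [extendFun_intoIoo, mul_smul]
    · simp only [extendFun_of_notMem _ ht])

theorem extendHom_smul_intoIoo (h : HomeoPlus) (s : ℝ) :
    extendHom h • intoIoo s = intoIoo (h • s) := extendFun_intoIoo h s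

theorem extendHom_smul_of_notMem (h : HomeoPlus) {t : ℝ} (ht : t ∉ Set.Ioo (-1 : ℝ) 1) :
    extendHom h • t = t := extendFun_of_notMem h ht

theorem extendHom_injective : Function.Injective extendHom := by
  rw [injective_iff_map_eq_one]
  intro h hh
  refine homeo_ext fun t => strictMono_intoIoo.injective ?_
  rw [← extendHom_smul_intoIoo, hh, one_smul, one_smul]

theorem preimage_supp_extendHom (h : HomeoPlus) : intoIoo ⁻¹' supp (extendHom h) = supp h := by
  ext s
  rw [Set.mem_preimage, mem_supp, mem_supp, extendHom_smul_intoIoo,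
    strictMono_intoIoo.injective.ne_iff]

theorem finite_frontier_extendHom {h : HomeoPlus} (hfin : (frontier (supp h)).Finite) :
    (Set.Ioo (-1 : ℝ) 1 ∩ frontier (supp (extendHom h))).Finite := by
  refine (hfin.image intoIoo).subset ?_
  rintro t ⟨ht, htf⟩
  obtain ⟨s, rfl⟩ := exists_intoIoo_eq ht
  refine ⟨s, ?_, rfl⟩
  rw [← preimage_supp_extendHom,
    ← isOpenEmbedding_intoIoo.isOpenMap.preimage_frontier_eq_frontier_preimage
      isOpenEmbedding_intoIoo.continuous]
  exact htf

/-- The copies of `Homeo⁺(ℝ)` supported in the images of `(-1, 1)`. -/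
noncomputable def conjExtendHom (g : HomeoPlus) : HomeoPlus →* HomeoPlus :=
  (MulAut.conj g).toMonoidHom.comp extendHom

theorem conjExtendHom_apply (g h : HomeoPlus) : conjExtendHom g h = g * extendHom h * g⁻¹ := rfl

theorem conjExtendHom_injective (g : HomeoPlus) : Function.Injective (conjExtendHom g) :=
  (MulAut.conj g).injective.comp extendHom_injective

theorem conjExtendHom_smul_of_notMem {g : HomeoPlus} {p q : ℝ}
    (hg : ∀ t ∈ Set.Icc (-1 : ℝ) 1, g • t ∈ Set.Ioo p q) (h : HomeoPlus) {t : ℝ}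
    (ht : t ∉ Set.Ioo p q) : conjExtendHom g h • t = t := by
  rw [conjExtendHom_apply, mul_smul, mul_smul, extendHom_smul_of_notMem, smul_inv_smul]
  intro hc
  have := hg _ ⟨hc.1.le, hc.2.le⟩
  rw [smul_inv_smul] at this
  exact ht this

end Extension

/-! ### Embedding `G` into `L` and into `L'` -/

section Embedding

/-- The `n` generators span `ℤⁿ`, and a surjective endomorphism of `ℤⁿ` is injective, so they form a
basis; `χ` gives the coordinates in it. -/
theorem exists_hom_single {Γ : Type*} [Group Γ] {n : ℕ} (x : Fin n → Γ)
    (hx : Subgroup.closure (Set.range x) = ⊤)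
    (Θ : Abelianization Γ ≃* Multiplicative (Fin n → ℤ)) :
    ∃ χ : Γ →* (Fin n → Multiplicative ℤ), ∀ i, χ (x i) = Pi.mulSingle i (Multiplicative.ofAdd 1) := by
  set u : Fin n → (Fin n → ℤ) := fun i => (Θ (Abelianization.of (x i))).toAdd with hu
  set T : (Fin n → ℤ) →ₗ[ℤ] (Fin n → ℤ) := (Pi.basisFun ℤ (Fin n)).constr ℤ u with hT
  have hTe : ∀ i, T (Pi.single i 1) = u i := fun i => by
    rw [hT, ← Pi.basisFun_apply, Module.Basis.constr_basis]
  have hsurj : Function.Surjective T := by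
    intro z
    obtain ⟨w, hw⟩ := Θ.surjective (Multiplicative.ofAdd z)
    obtain ⟨g, rfl⟩ := QuotientGroup.mk_surjective w
    have hmem : g ∈ Subgroup.closure (Set.range x) := hx ▸ Subgroup.mem_top g
    have key : ∀ g ∈ Subgroup.closure (Set.range x),
        (Θ (Abelianization.of g)).toAdd ∈ LinearMap.range T := by
      intro g hg
      induction hg using Subgroup.closure_induction with
      | mem g hg =>
        obtain ⟨i, rfl⟩ := hg
        exact ⟨_, hTe i⟩
      | one => simp
      | mul f g _ _ hf hg => simpa using add_mem hf hg
      | inv f _ hf => simpa using hf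
    obtain ⟨y, hy⟩ := key g hmem
    exact ⟨y, hy.trans (congrArg Multiplicative.toAdd hw)⟩
  have hinj : Function.Injective T := OrzechProperty.injective_of_surjective_endomorphism T hsurj
  set e := LinearEquiv.ofBijective T ⟨hinj, hsurj⟩ with he
  refine ⟨MonoidHom.mk' (fun g j =>
    Multiplicative.ofAdd (e.symm (Θ (Abelianization.of g)).toAdd j)) ?_, fun i => ?_⟩
  · intro f g
    funext j
    simp
  · funext j
    have : e.symm (u i) = Pi.single i 1 := by
      rw [LinearEquiv.symm_apply_eq]; exact (hTe i).symm
    change Multiplicative.ofAdd (e.symm (u i) j) = _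
    rw [this]
    by_cases hij : j = i
    · subst hij; simp
    · simp [hij]

variable {n m : ℕ} {h : Fin n → HomeoPlus} {J : HomeoPlus →* HomeoPlus}
  {k : Fin m → HomeoPlus}

theorem embedsInto_extGroup (hJ : Function.Injective J) (hmem : ∀ i, J (h i) ∈ extGroup k) :
    EmbedsInto (Subgroup.closure (Set.range h)) (extGroup k) := by
  have hle : Subgroup.closure (Set.range h) ≤ (extGroup k).comap J := by
    rw [Subgroup.closure_le]
    rintro _ ⟨i, rfl⟩
    exact hmem i
  exact ⟨(J.comp (Subgroup.subtype _)).codRestrict _ fun g => hle g.2,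
    (MonoidHom.injective_codRestrict _ _ _).2 (hJ.comp (Subgroup.subtype_injective _))⟩

/-- If the abelianization is free on the generators, correct each generator by the inverse of a
translate to land in the commutator subgroup. -/
theorem embedsInto_commutator_extGroup (hJ : Function.Injective J)
    (hJs : ∀ f, ∀ t ∉ Set.Ioo (1 / 2 : ℝ) (3 / 4), J f • t = t)
    (hmem : ∀ i, J (h i) ∈ extGroup k)
    (hab : Nonempty (Abelianization (Subgroup.closure (Set.range h)) ≃*
      Multiplicative (Fin n → ℤ))) :
    EmbedsInto (Subgroup.closure (Set.range h)) (commutator (extGroup k)) := by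
  set G := Subgroup.closure (Set.range h) with hG
  set Λ := extGroup k with hΛ
  set x : Fin n → G := fun i => ⟨h i, Subgroup.subset_closure ⟨i, rfl⟩⟩ with hx
  have htop : Subgroup.closure (Set.range x) = ⊤ := by
    rw [eq_top_iff]
    rintro ⟨g, hg⟩ -
    induction hg using Subgroup.closure_induction with
    | mem g hg =>
      obtain ⟨i, rfl⟩ := hg
      exact Subgroup.subset_closure ⟨i, rfl⟩
    | one => exact one_mem _
    | mul f g _ _ hf hg => exact mul_mem hf hg
    | inv f _ hf => exact inv_mem hf
  obtain ⟨Θ⟩ := hab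
  obtain ⟨χ, hχ⟩ := exists_hom_single x htop Θ
  -- The shift by `i + 1`, not `i`, keeps these supports disjoint from `(1/2, 3/4)` as well as from
  -- each other, so everything commutes.
  set y : Fin n → HomeoPlus := fun i =>
    mapA ^ ((i : ℕ) + 1) * (J (h i))⁻¹ * (mapA ^ ((i : ℕ) + 1))⁻¹ with hy
  have hyfix : ∀ i : Fin n, ∀ t : ℝ, t - ((i : ℕ) + 1) ∉ Set.Ioo (1 / 2 : ℝ) (3 / 4) → y i • t = t := by
    intro i t ht
    simp only [hy]
    rw [mul_smul, mul_smul, mapA_pow_inv_smul, mapA_pow_smul, ← map_inv, hJs]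
    · ring
    · push_cast; exact ht
  have hycomm : Pairwise fun i j => ∀ a b,
      Commute (zpowersHom HomeoPlus (y i) a) (zpowersHom HomeoPlus (y j) b) := by
    intro i j hij a b
    rw [zpowersHom_apply, zpowersHom_apply]
    refine Commute.zpow_zpow ?_ _ _
    refine commute_of_fix (I := {t : ℝ | t - ((j : ℕ) + 1) ∈ Set.Ioo (1 / 2 : ℝ) (3 / 4)})
      (fun t ht => hyfix i t fun hc => ?_) fun t ht => hyfix j t ht
    have ht' : t - ((j : ℕ) + 1) ∈ Set.Ioo (1 / 2 : ℝ) (3 / 4) := ht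
    have hne : (i : ℕ) ≠ j := fun h => hij (Fin.ext h)
    rcases hne.lt_or_gt with hlt | hlt
    · have : ((i : ℕ) : ℝ) + 1 ≤ (j : ℕ) := by exact_mod_cast hlt
      linarith [hc.2, ht'.1]
    · have : ((j : ℕ) : ℝ) + 1 ≤ (i : ℕ) := by exact_mod_cast hlt
      linarith [hc.1, ht'.2]
  set τ : (Fin n → Multiplicative ℤ) →* HomeoPlus :=
    MonoidHom.noncommPiCoprod (fun i => zpowersHom HomeoPlus (y i)) hycomm with hτ
  have hτfix : ∀ z, ∀ t ∈ Set.Ioo (1 / 2 : ℝ) (3 / 4), τ z • t = t := by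
    intro z t ht
    have hle : τ.range ≤ MulAction.stabilizer HomeoPlus t := by
      rw [hτ, MonoidHom.noncommPiCoprod_range]
      refine iSup_le fun i => ?_
      rintro _ ⟨a, rfl⟩
      rw [zpowersHom_apply]
      refine zpow_mem ?_ _
      refine hyfix i t fun hc => ?_
      have : (0 : ℝ) ≤ (i : ℕ) := Nat.cast_nonneg _
      linarith [ht.2, hc.1]
    exact hle ⟨z, rfl⟩
  have hcomm : ∀ f g : G, Commute ((J.comp G.subtype) f) ((τ.comp χ) g) := fun f g =>
    (commute_of_fix (hτfix (χ g)) (hJs f)).symm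
  set φ : G →* HomeoPlus :=
    ((J.comp G.subtype).noncommCoprod (τ.comp χ) hcomm).comp ((MonoidHom.id G).prod (MonoidHom.id G))
    with hφ
  have hφa : ∀ g, φ g = J g * τ (χ g) := fun g => rfl
  have hφinj : Function.Injective φ := by
    rw [injective_iff_map_eq_one]
    intro g hg
    have hJg : J g = 1 := by
      refine homeo_ext fun t => ?_
      rw [one_smul]
      by_cases ht : t ∈ Set.Ioo (1 / 2 : ℝ) (3 / 4)
      · have h1 : φ g • t = t := by rw [hg, one_smul]
        rwa [hφa, mul_smul, hτfix _ t ht] at h1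
      · exact hJs _ t ht
    exact Subtype.ext (hJ (hJg.trans (map_one J).symm))
  have hφmem : ∀ g, φ g ∈ (⁅Λ, Λ⁆ : Subgroup HomeoPlus) := by
    have hle : (⊤ : Subgroup G) ≤ (⁅Λ, Λ⁆ : Subgroup HomeoPlus).comap φ := by
      rw [← htop, Subgroup.closure_le]
      rintro _ ⟨i, rfl⟩
      change φ (x i) ∈ (⁅Λ, Λ⁆ : Subgroup HomeoPlus)
      -- The correction factor is exactly the second half of this commutator.
      have e : φ (x i) = ⁅J (h i), mapA ^ ((i : ℕ) + 1)⁆ := by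
        rw [hφa, hχ, hτ, MonoidHom.noncommPiCoprod_mulSingle, zpowersHom_apply,
          commutatorElement_def]
        simp only [hx, hy, toAdd_ofAdd, zpow_one, mul_assoc]
      rw [e]
      exact Subgroup.commutator_mem_commutator (hmem i) (pow_mem (mapA_mem k) _)
    exact fun g => hle (Subgroup.mem_top g)
  rw [← Subgroup.map_subtype_commutator] at hφmem
  set E := (commutator Λ).equivMapOfInjective _ Λ.subtype_injective
  refine ⟨E.symm.toMonoidHom.comp (φ.codRestrict _ hφmem), ?_⟩
  exact E.symm.injective.comp ((MonoidHom.injective_codRestrict _ _ _).2 hφinj)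

/-- The first conjugation reaches `F` with no control on the support; a contraction taken from `F`
then moves it into `(1/2, 3/4)` without leaving `F`. -/
theorem exists_conjugator_of_finite {f : HomeoPlus} (hf : HasFinitelyManyComponents (supp f)) :
    ∃ g : HomeoPlus, (∀ t ∈ Set.Icc (-1 : ℝ) 1, g • t ∈ Set.Ioo (1 / 2 : ℝ) (3 / 4)) ∧
      conjExtendHom g f ∈ ThompsonF := by
  obtain ⟨ψ, hψ⟩ := exists_conj_mem_thompsonF (h := extendHom f) (by norm_num : (-1 : ℝ) < 1)
    (fun t ht => extendHom_smul_of_notMem f ht)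
    (finite_frontier_extendHom (hf.frontier_finite (isOpen_supp f)))
  obtain ⟨c, hc, hcI⟩ := exists_thompsonF_contracting (ψ • (-1 : ℝ)) (ψ • (1 : ℝ))
    (by norm_num : (1 / 2 : ℝ) < 3 / 4)
  refine ⟨c * ψ, fun t ht => ?_, ?_⟩
  · rw [mul_smul]
    exact hcI _ ⟨(homeo_smul_le_smul ψ).2 ht.1, (homeo_smul_le_smul ψ).2 ht.2⟩
  · have : conjExtendHom (c * ψ) f = c * (ψ * extendHom f * ψ⁻¹) * c⁻¹ := by
      rw [conjExtendHom_apply]; group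
    rw [this]
    exact mul_mem (mul_mem hc hψ) (inv_mem hc)

theorem exists_chainGroup {n m : ℕ} (h : Fin n → HomeoPlus) (g : HomeoPlus)
    (hg : ∀ t ∈ Set.Icc (-1 : ℝ) 1, g • t ∈ Set.Ioo (1 / 2 : ℝ) (3 / 4)) (σ : Fin m → Fin n)
    (hσ : ∀ i, i ∈ Set.range σ ∨ conjExtendHom g (h i) ∈ ThompsonF) :
    ∃ L : Subgroup HomeoPlus, IsChainGroup (m + 2) L ∧ IsSimpleGroup (commutator L) ∧
      EmbedsInto (Subgroup.closure (Set.range h)) L ∧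
      (Nonempty (Abelianization (Subgroup.closure (Set.range h)) ≃*
        Multiplicative (Fin n → ℤ)) →
          EmbedsInto (Subgroup.closure (Set.range h)) (commutator L)) := by
  set k : Fin m → HomeoPlus := fun i => conjExtendHom g (h (σ i)) with hk
  have hfix : ∀ f, ∀ t ∉ Set.Ioo (1 / 2 : ℝ) (3 / 4), conjExtendHom g f • t = t :=
    fun f t ht => conjExtendHom_smul_of_notMem hg f ht
  have hmem : ∀ i, conjExtendHom g (h i) ∈ extGroup k := by
    intro i
    rcases hσ i with ⟨j, rfl⟩ | hi
    · exact mem_extGroup k j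
    · exact thompsonF_le k hi
  exact ⟨extGroup k, isChainGroup_extGroup k fun i => hfix _,
    isSimpleGroup_commutator_extGroup k fun i => hfix _,
    embedsInto_extGroup (conjExtendHom_injective g) hmem,
    embedsInto_commutator_extGroup (conjExtendHom_injective g) hfix hmem⟩

end Embedding

end ChainGroup

theorem mainTheorem3 (n : ℕ) (hn : 1 ≤ n) (h : Fin n → HomeoPlus) (G : Subgroup HomeoPlus)
    (hG : G = Subgroup.closure (Set.range h)) :
    -- general case: an (n+2)-chain group
    (∃ L : Subgroup HomeoPlus, ChainGroup.IsChainGroup (n + 2) L ∧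
      IsSimpleGroup (commutator L) ∧ ChainGroup.EmbedsInto G L) ∧
    -- some generator has finitely many support components: an (n+1)-chain group
    ((∃ i, ChainGroup.HasFinitelyManyComponents (ChainGroup.supp (h i))) →
      ∃ L : Subgroup HomeoPlus, ChainGroup.IsChainGroup (n + 1) L ∧
        IsSimpleGroup (commutator L) ∧ ChainGroup.EmbedsInto G L) ∧
    -- in both cases, if `G/G' ≅ ℤⁿ`, then `G` can be embedded into `L'`
    (Nonempty (Abelianization G ≃* Multiplicative (Fin n → ℤ)) →
      (∃ L : Subgroup HomeoPlus, ChainGroup.IsChainGroup (n + 2) L ∧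
        IsSimpleGroup (commutator L) ∧ ChainGroup.EmbedsInto G (commutator L)) ∧
      ((∃ i, ChainGroup.HasFinitelyManyComponents (ChainGroup.supp (h i))) →
        ∃ L : Subgroup HomeoPlus, ChainGroup.IsChainGroup (n + 1) L ∧
          IsSimpleGroup (commutator L) ∧ ChainGroup.EmbedsInto G (commutator L))) := by
  subst hG
  obtain ⟨g, -, hg⟩ := ChainGroup.exists_thompsonF_contracting (-1) 1
    (by norm_num : (1 / 2 : ℝ) < 3 / 4)
  obtain ⟨L, hL, hs, he, hc⟩ := ChainGroup.exists_chainGroup h g hg id fun i => Or.inl ⟨i, rfl⟩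
  have key : (∃ i, ChainGroup.HasFinitelyManyComponents (ChainGroup.supp (h i))) →
      ∃ L : Subgroup HomeoPlus, ChainGroup.IsChainGroup (n + 1) L ∧
        IsSimpleGroup (commutator L) ∧
        ChainGroup.EmbedsInto (Subgroup.closure (Set.range h)) L ∧
        (Nonempty (Abelianization (Subgroup.closure (Set.range h)) ≃*
          Multiplicative (Fin n → ℤ)) →
            ChainGroup.EmbedsInto (Subgroup.closure (Set.range h)) (commutator L)) := by
    rintro ⟨i, hi⟩
    obtain ⟨g, hg, hgF⟩ := ChainGroup.exists_conjugator_of_finite hi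
    obtain ⟨m, rfl⟩ : ∃ m, n = m + 1 := ⟨n - 1, by omega⟩
    -- `succAbove` omits index `i`, whose copy already lies in `F`; this saves one link of the
    -- chain.
    refine ChainGroup.exists_chainGroup h g hg i.succAbove fun j => ?_
    rcases eq_or_ne j i with rfl | hji
    · exact Or.inr hgF
    · exact Or.inl (Fin.exists_succAbove_eq hji)
  refine ⟨⟨L, hL, hs, he⟩, fun hi => ?_, fun hab => ⟨⟨L, hL, hs, hc hab⟩, fun hi => ?_⟩⟩
  · obtain ⟨M, hM, hsM, heM, -⟩ := key hi
    exact ⟨M, hM, hsM, heM⟩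
  · obtain ⟨M, hM, hsM, -, hcM⟩ := key hi
    exact ⟨M, hM, hsM, hcM hab⟩
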